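/- Let $d\ge 3$. Write $|\cdot|$ for the Euclidean norm, and $B(z,r)=\{y\in\mathbb Z^d: |y-z|_\infty\le r\}$. Let $P_y$ be the law of the continuous-time simple random walk $(X_t)_{t\ge0}$ on $\mathbb Z^d$ with mean-one exponential holding times started at $y$. For $K\subset\mathbb Z^d$ let $H_K=\inf\{t\ge 0:X_t\in K\}$, $T_K=H_{\mathbb Z^d\setminus K}$ and $\widetilde H_K=\inf\{t\ge0: X_t\in K,\ X_s\ne X_0 \text{ for some } s\in[0,t]\}$; for finite $K$ let $e_K(y)=P_y[\widetilde H_K=\infty]1_{\{y\in K\}}$ and $\mathrm{cap}(K)=\sum_y e_K(y)$. Let $u_*=u_*(d)$ be the critical level of the vacant set $\mathcal V^u$ of random interlacements on $\mathbb Z^d$, i.e. the infimum of the $u>0$ for which all connected components of $\mathcal V^u$ are almost surely finite, where $\mathcal V^u$ is the random subset of $\mathbb Z^d$ with $\mathbb P[K\subset\mathcal V^u]=e^{-u\,\mathrm{cap}(K)}$ for all finite $K$. For each $p\in\mathbb R^d$ fix a point $[p]\in\mathbb Z^d$ at minimal Euclidean distance from $p$. For $x\in\mathbb Z^d\setminus\{0\}$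 and $\delta\in(0,\frac16)$ put $e=x/|x|$, $T(x)=\{[je]: j \in \mathbb Z,\ 0\le j\le \lceil |x|\rceil\}$, $T(x,r)=\{y\in\mathbb Z^d: d(y,T(x))\le r\}$ (Euclidean distance), $T^i=T(x,(|x|\vee100)^{i\delta})$ for $1\le i\le5$, $T^6=T(x,4(|x|\vee100)^{5\delta})$ and $U=B(0,10^3|x|)$. Let $r_1=\big(100\vee\frac{|x|^\delta}{100}\big)^{1/4}$ and $B_i^z=B(z,r_1^{(i+2)/8})$. Let $\Gamma(x)=\Gamma_{\rm int}\cup\Gamma_{\rm ext}$, where $\Gamma_{\rm int}=T(x)$ and $\Gamma_{\rm ext}=\partial T^4$ is the set of points of $T^4$ having a lattice neighbour outside $T^4$. For $\varepsilon\in(0,\frac{u_*}{10}\wedge1)$ and $0<v\le u$ let $$f(y)=1+\Big(\sqrt{\tfrac{u_*+\varepsilon}{v}}-1\Big)P_y[H_{T^6}<T_U]-\Big(\sqrt{\tfrac{u_*+\varepsilon}{v}}-\sqrt{\tfrac{u_*-\varepsilon}{u}}\Big)P_y[H_{T^2}<T_{T^3}],\qquad y\in\mathbb Z^d.$$ With $\Delta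 f(y)=\frac1{2d}\sum_{|a|=1}(f(y+a)-f(y))$ and $V_f=-\Delta f/f$, let $\widetilde P^f_y$ be given by $\frac{d\widetilde P_y^f}{dP_y}=\frac1{f(y)}\exp\big(\int_0^\infty V_f(X_s)\,ds\big)$, and for finite $K$ let $$\tilde e_K(y)=\widetilde P_y^f[\widetilde H_K=\infty]\,1_{\{y\in K\}}\,f(y)\,\frac1{2d}\sum_{|a|=1}f(y+a),\qquad \widetilde{\mathrm{cap}}_f(K)=\sum_y\tilde e_K(y).$$ For $z\in\Gamma(x)$ let $\tilde u_f^z=u$ if $z\in\Gamma_{\rm int}$, $\tilde u_f^z=v$ if $z\in\Gamma_{\rm ext}$, and $u_f^z=f(z)^2\,\tilde u_f^z$. **Proposition.** For all $\epsilon_0\in(0,1)$, $\delta\in(0,\frac16)$, $\varepsilon\in(0,\frac{u_*}{10}\wedge1)$ and $0<v\le u$ there is a constant $C=C(d,\epsilon_0,\delta,u,v,\varepsilon)\in(0,\infty)$, not depending on the choice of $[\cdot]$, such that for all $x\in\mathbb Z^d$ with $|x|\ge C$ and all $z\in\Gamma(x)$: the levels $\tilde u_f^z$ are well defined, $u_f^z=u_*-\varepsilon$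 if $z\in\Gamma_{\rm int}$, $u_f^z=u_*+\varepsilon$ if $z\in\Gamma_{\rm ext}$, and $$(1-\epsilon_0)\,u_f^z\,\mathrm{cap}(B_2^z)\le\tilde u_f^z\,\widetilde{\mathrm{cap}}_f(B_2^z)\le(1+\epsilon_0)\,u_f^z\,\mathrm{cap}(B_2^z),$$ $$(1-\epsilon_0)\,u_f^z\,e_{B_1^z}(y)\le\tilde u_f^z\,\tilde e_{B_1^z}(y)\le(1+\epsilon_0)\,u_f^z\,e_{B_1^z}(y)\qquad\text{for all }y\in\mathbb Z^d.$$ -/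

import Mathlib

open MeasureTheory Set
open scoped NNReal ENNReal

namespace TiltedWalk

/-! ### Lattice geometry -/

/-- The lattice `ℤ^d`. -/
abbrev ZLat (d : ℕ) : Type := Fin d → ℤ

/-- The embedding of `ℤ^d` into Euclidean space `ℝ^d`. -/
noncomputable def toEuc {d : ℕ} (y : ZLat d) : EuclideanSpace ℝ (Fin d) :=
  WithLp.toLp 2 (fun i => (y i : ℝ))

/-- The Euclidean norm `|y|` of a lattice point. -/
noncomputable def eucNorm {d : ℕ} (y : ZLat d) : ℝ := ‖toEuc y‖

/-- The closed box `B(z,r) = {y ∈ ℤ^d : |y - z|_∞ ≤ r}` (the norm of `ZLat d` is the sup-norm). -/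
def box {d : ℕ} (z : ZLat d) (r : ℝ) : Set (ZLat d) := {y | ‖y - z‖ ≤ r}

/-- Inner vertex boundary: points of `K` having a lattice neighbour outside `K`. -/
def innerBoundary {d : ℕ} (K : Set (ZLat d)) : Set (ZLat d) :=
  {y | y ∈ K ∧ ∃ w, w ∉ K ∧ dist (toEuc y) (toEuc w) = 1}

/-- `rnd p` is, for each `p ∈ ℝ^d`, a lattice point achieving the Euclidean distance
of `p` to `ℤ^d`. -/
def IsLatticeRounding {d : ℕ} (rnd : EuclideanSpace ℝ (Fin d) → ZLat d) : Prop :=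
  ∀ p, dist p (toEuc (rnd p)) = Metric.infDist p (Set.range (toEuc (d := d)))

/-- The `2d` unit vectors `± e_i`. -/
def unitVec {d : ℕ} (s : Fin d × Bool) : ZLat d := Pi.single s.1 (if s.2 then 1 else -1)

/-! ### The continuous-time simple random walk

The walk is built from its successive jumps and holding times: `(ω n).1` is the direction of the
`(n+1)`-st jump, uniform among the `2d` unit vectors, and `(ω n).2` is the holding time preceding
it, exponential with mean one; all of these are independent. -/

/-- The sample space carrying jumps and holding times. -/
abbrev Sample (d : ℕ) : Type := ℕ → (Fin d × Bool) × ℝ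

/-- Uniform distribution on the `2d` directions. -/
noncomputable def dirMeasure (d : ℕ) [NeZero d] : Measure (Fin d × Bool) :=
  (PMF.uniformOfFintype (Fin d × Bool)).toMeasure

instance (d : ℕ) [NeZero d] : IsProbabilityMeasure (dirMeasure d) := by
  unfold dirMeasure; infer_instance

/-- Exponential distribution with mean one. -/
noncomputable def holdMeasure : Measure ℝ := ProbabilityTheory.expMeasure 1

instance : IsProbabilityMeasure holdMeasure :=
  ProbabilityTheory.isProbabilityMeasure_expMeasure one_pos

/-- The joint law of jumps and holding times. -/
noncomputable def sampleMeasure (d : ℕ) [NeZero d] : Measure (Sample d) :=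
  Measure.infinitePi (fun _ : ℕ => (dirMeasure d).prod holdMeasure)

/-- Position after `n` jumps of the walk started at `x`. -/
def skeleton {d : ℕ} (x : ZLat d) (ω : Sample d) (n : ℕ) : ZLat d :=
  x + ∑ i ∈ Finset.range n, unitVec (ω i).1

/-- Time of the `n`-th jump (time `0` for `n = 0`). -/
noncomputable def jumpTime {d : ℕ} (ω : Sample d) (n : ℕ) : ℝ :=
  ∑ i ∈ Finset.range n, (ω i).2

/-- Position `X_t` at time `t ≥ 0` of the walk started at `x`: the number of jumps made up to time
`t` is the largest `n` with `jumpTime ω n ≤ t`. The law of `(X_t)` under `sampleMeasure d`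
is `P_x`. -/
noncomputable def walk {d : ℕ} (x : ZLat d) (ω : Sample d) (t : ℝ) : ZLat d :=
  skeleton x ω (sSup {n : ℕ | jumpTime ω n ≤ t})

/-- Entrance time `H_K = inf {t ≥ 0 : X_t ∈ K}`. -/
noncomputable def entranceTime {d : ℕ} (K : Set (ZLat d)) (x : ZLat d) (ω : Sample d) : ℝ≥0∞ :=
  ⨅ (t : ℝ≥0) (_ : walk x ω t ∈ K), (t : ℝ≥0∞)

/-- Exit time `T_K = H_{ℤ^d ∖ K}`. -/
noncomputable def exitTime {d : ℕ} (K : Set (ZLat d)) (x : ZLat d) (ω : Sample d) : ℝ≥0∞ :=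
  entranceTime Kᶜ x ω

/-- Hitting time `H̃_K = inf {t ≥ 0 : X_t ∈ K and X_s ≠ X_0 for some s ∈ [0,t]}`. -/
noncomputable def returnTime {d : ℕ} (K : Set (ZLat d)) (x : ZLat d) (ω : Sample d) : ℝ≥0∞ :=
  ⨅ (t : ℝ≥0) (_ : walk x ω t ∈ K ∧ ∃ s : ℝ≥0, s ≤ t ∧ walk x ω s ≠ walk x ω 0), (t : ℝ≥0∞)

/-- `P_y[H_A < T_B]`. -/
noncomputable def hitBeforeExit {d : ℕ} [NeZero d] (A B : Set (ZLat d)) (y : ZLat d) : ℝ :=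
  (sampleMeasure d).real {ω | entranceTime A y ω < exitTime B y ω}

open Classical in
/-- Equilibrium measure `e_K(y) = P_y[H̃_K = ∞] 1{y ∈ K}`. -/
noncomputable def eqMeasure {d : ℕ} [NeZero d] (K : Set (ZLat d)) (y : ZLat d) : ℝ :=
  if y ∈ K then (sampleMeasure d).real {ω | returnTime K y ω = ⊤} else 0

/-- Capacity of `K`, the total mass of the equilibrium measure. -/
noncomputable def capacity {d : ℕ} [NeZero d] (K : Set (ZLat d)) : ℝ := ∑' y, eqMeasure K y

/-! ### The tilted walk -/

/-- `(1/2d) ∑_{|e|=1} f(y+e)`. -/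
noncomputable def nbrAverage {d : ℕ} (f : ZLat d → ℝ) (y : ZLat d) : ℝ :=
  (1 / (2 * (d : ℝ))) * ∑ s : Fin d × Bool, f (y + unitVec s)

/-- `V_f = - Δf / f` with the discrete Laplacian `Δf(y) = (1/2d) ∑_{|e|=1} (f(y+e) - f(y))`. -/
noncomputable def potential {d : ℕ} (f : ZLat d → ℝ) (y : ZLat d) : ℝ :=
  -((1 / (2 * (d : ℝ))) * ∑ s : Fin d × Bool, (f (y + unitVec s) - f y)) / f y

/-- The tilted measure `P̃_x^f`, with density `f(x)⁻¹ exp (∫_0^∞ V_f(X_s) ds)`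
with respect to `P_x`. -/
noncomputable def tiltedMeasure {d : ℕ} [NeZero d] (f : ZLat d → ℝ) (x : ZLat d) :
    Measure (Sample d) :=
  (sampleMeasure d).withDensity fun ω =>
    ENNReal.ofReal ((1 / f x) * Real.exp (∫ s in Set.Ioi (0 : ℝ), potential f (walk x ω s)))

open Classical in
/-- Tilted equilibrium measure
`ẽ_K(y) = P̃_y^f[H̃_K = ∞] 1{y ∈ K} f(y) (1/2d) ∑_{|e|=1} f(y+e)`. -/
noncomputable def tiltedEqMeasure {d : ℕ} [NeZero d] (f : ZLat d → ℝ) (K : Set (ZLat d))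
    (y : ZLat d) : ℝ :=
  if y ∈ K then (tiltedMeasure f y).real {ω | returnTime K y ω = ⊤} * (f y * nbrAverage f y)
  else 0

/-- Tilted capacity, the total mass of the tilted equilibrium measure. -/
noncomputable def tiltedCapacity {d : ℕ} [NeZero d] (f : ZLat d → ℝ) (K : Set (ZLat d)) : ℝ :=
  ∑' y, tiltedEqMeasure f K y

/-! ### The critical level of the vacant set of random interlacements -/

/-- `μ` is the law of the vacant set `𝒱^u` of random interlacements at level `u`: the (unique)
probability measure on subsets of `ℤ^d` with `μ[K ⊆ 𝒱] = exp(-u cap(K))` for all finite `K`. -/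
def IsVacantSetLaw {d : ℕ} [NeZero d] (u : ℝ) (μ : Measure (Set (ZLat d))) : Prop :=
  IsProbabilityMeasure μ ∧
    ∀ K : Finset (ZLat d), μ {S | (K : Set (ZLat d)) ⊆ S} =
      ENNReal.ofReal (Real.exp (-(u * capacity (K : Set (ZLat d)))))

/-- The points that can be reached from `y` by a nearest-neighbour path in `S`. -/
def cluster {d : ℕ} (S : Set (ZLat d)) (y : ZLat d) : Set (ZLat d) :=
  {w | Relation.ReflTransGen
    (fun a b => a ∈ S ∧ b ∈ S ∧ dist (toEuc a) (toEuc b) = 1) y w}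

/-- The critical level `u_* = u_*(d)`: the infimum of the levels `u > 0` at which almost surely
all connected components of the vacant set `𝒱^u` are finite. -/
noncomputable def criticalLevel (d : ℕ) [NeZero d] : ℝ :=
  sInf {u : ℝ | 0 < u ∧ ∃ μ : Measure (Set (ZLat d)), IsVacantSetLaw u μ ∧
    ∀ᵐ S ∂μ, ∀ y, (cluster S y).Finite}

/-! ### Tubes, boxes and the profile function -/

/-- The discretized segment `T(x) = {[j e] : 0 ≤ j ≤ ⌈|x|⌉}`, `e = x/|x|`. -/
def discSegment {d : ℕ} (rnd : EuclideanSpace ℝ (Fin d) → ZLat d) (x : ZLat d) : Set (ZLat d) :=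
  {y | ∃ j : ℕ, j ≤ ⌈eucNorm x⌉₊ ∧ y = rnd ((j : ℝ) • ((eucNorm x)⁻¹ • toEuc x))}

/-- The tube `T(x,r) = {y ∈ ℤ^d : d(y,T(x)) ≤ r}` (Euclidean distance). -/
def tube {d : ℕ} (rnd : EuclideanSpace ℝ (Fin d) → ZLat d) (x : ZLat d) (r : ℝ) : Set (ZLat d) :=
  {y | Metric.infDist (toEuc y) (toEuc '' discSegment rnd x) ≤ r}

/-- The tubes `T^i = T(x, (|x| ∨ 100)^{iδ})`, used for `1 ≤ i ≤ 5`. -/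
def tubeT {d : ℕ} (rnd : EuclideanSpace ℝ (Fin d) → ZLat d) (δ : ℝ) (x : ZLat d) (i : ℕ) :
    Set (ZLat d) :=
  tube rnd x ((max (eucNorm x) 100) ^ ((i : ℝ) * δ))

/-- The tube `T^6 = T(x, 4 (|x| ∨ 100)^{5δ})`. -/
def tubeT6 {d : ℕ} (rnd : EuclideanSpace ℝ (Fin d) → ZLat d) (δ : ℝ) (x : ZLat d) : Set (ZLat d) :=
  tube rnd x (4 * (max (eucNorm x) 100) ^ (5 * δ))

/-- The box `U = B(0, 10³ |x|)`. -/
def bigBox {d : ℕ} (x : ZLat d) : Set (ZLat d) := box 0 (10 ^ 3 * eucNorm x)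

/-- The profile function `f = f^{v,u;ε}`, where `h₁(y) = P_y[H_{T²} < T_{T³}]` and
`h₂(y) = P_y[H_{T⁶} < T_U]`. -/
noncomputable def profile {d : ℕ} [NeZero d] (rnd : EuclideanSpace ℝ (Fin d) → ZLat d) (δ : ℝ)
    (x : ZLat d) (u v ε : ℝ) (y : ZLat d) : ℝ :=
  1 + (√((criticalLevel d + ε) / v) - 1) * hitBeforeExit (tubeT6 rnd δ x) (bigBox x) y
    - (√((criticalLevel d + ε) / v) - √((criticalLevel d - ε) / u)) *
      hitBeforeExit (tubeT rnd δ x 2) (tubeT rnd δ x 3) y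

/-- `r₁ = r₀^{1/4}` with `r₀ = 100 ∨ (|x|^δ / 100)`. -/
noncomputable def radiusOne {d : ℕ} (δ : ℝ) (x : ZLat d) : ℝ :=
  (max 100 (eucNorm x ^ δ / 100)) ^ (1 / 4 : ℝ)

/-- The boxes `B_i^z = B(z, r₁^{(i+2)/8})`. -/
def boxB {d : ℕ} (δ : ℝ) (x : ZLat d) (i : ℕ) (z : ZLat d) : Set (ZLat d) :=
  box z (radiusOne δ x ^ (((i : ℝ) + 2) / 8))

/-- `Γ_int = T(x)`. -/
def gammaInt {d : ℕ} (rnd : EuclideanSpace ℝ (Fin d) → ZLat d) (x : ZLat d) : Set (ZLat d) :=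
  discSegment rnd x

/-- `Γ_ext = ∂T⁴`. -/
def gammaExt {d : ℕ} (rnd : EuclideanSpace ℝ (Fin d) → ZLat d) (δ : ℝ) (x : ZLat d) :
    Set (ZLat d) :=
  innerBoundary (tubeT rnd δ x 4)

open Classical in
/-- The level `ũ_f^z`, for `z ∈ Γ_int ∪ Γ_ext`: `u` if `z ∈ Γ_int` and `v` if `z ∈ Γ_ext`. -/
noncomputable def levelTilde {d : ℕ} (rnd : EuclideanSpace ℝ (Fin d) → ZLat d) (x : ZLat d)
    (u v : ℝ) (z : ZLat d) : ℝ :=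
  if z ∈ gammaInt rnd x then u else v

/-- The effective level `u_f^z = f(z)² ũ_f^z`. -/
noncomputable def level {d : ℕ} [NeZero d] (rnd : EuclideanSpace ℝ (Fin d) → ZLat d) (δ : ℝ)
    (x : ZLat d) (u v ε : ℝ) (z : ZLat d) : ℝ :=
  profile rnd δ x u v ε z ^ 2 * levelTilde rnd x u v z

end TiltedWalk

open TiltedWalk

/-!
Dividing by `f`, the tilted walk is a random walk among the conductances `f(y) f(y')`, and near `z`
the function `f` is constant, so that there the walk and the tilted walk have the same law. The
equilibrium measure of a small box `K` at `z` is governed by two events: the walk leaves a much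
larger ball without returning to `K`, and from the boundary of that ball it never comes back to `K`.
The first has the same probability for both walks. It remains to see that the second has probability
close to one, for both. Nothing about `f` is needed beyond uniform positive bounds,
constancy near `z`, and `f = 1` off a finite set; in particular harmonicity plays no role.

*Reduction to a difference equation.* Integrating out the exponential holding times, with
`E[e^{vτ}] = 1/(1-v)`, the function `gauge f K y = E_y[exp(∫ V_f(X_s) ds); X avoids K]` solves
`G = (f / Pf) PG` off `K`, where `P` is the averaging operator (`gauge_mul_nbrAverage`). Moreover
`G ≤ f` by Fatou's lemma and the martingale property of the Feynman–Kac weights (`gauge_le`),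
`G / f → 1` at infinity by transience (`tendsto_one_sub_gauge_div`), and the tilted equilibrium
measure is `f PG` on `K` (`tiltedEqMeasure_eq`). The untilted walk is the case `f = 1`.

*Hitting probabilities.* `φ = 1 - G/f` is the equilibrium potential of `K` for the conductances
`f(y) f(y')`. Its Dirichlet energy is at most of order `|K|` (`energy_truncation_le`), because the
conductances are bounded above and below. Near a point `w` at distance of order `R` from `K`, `φ` is
harmonic for the simple random walk, hence bounded by its average under the law of the walk at time
`t ~ R`, up to an error `t / R²` (`le_iterate_nbrAverage_add`). By Cauchy–Schwarz for the Dirichlet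
form this average is controlled by the energy and by the Green function after time `2t`
(`tsum_heatKernel_mul_le_energy`), and the latter by the bound `p_n ≤ A n^{-d/2}`, which follows from
Fourier inversion (`exists_heatKernel_le`). The result is `potential_le`. The crude bound `|K|` on the
energy suffices since `R` is at least the sixteenth power of the radius of `K`
(`exists_error_le`).

*Conclusion.* Inside the large ball both gauge functions are harmonic off `K`, vanish on `K`, and
have nearly the same boundary values up to the constant factor `f(z)`; the maximum principle compares
them everywhere (`tiltedEqMeasure_comparison`).
-/

namespace TiltedWalk

/-! ### Averaging over lattice neighbours and the heat kernel -/

/-- The direction opposite to `s`. -/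
def flipDir {d : ℕ} : (Fin d × Bool) ≃ (Fin d × Bool) :=
  Equiv.prodCongr (Equiv.refl _) Equiv.boolNot

lemma unitVec_flipDir {d : ℕ} (s : Fin d × Bool) : unitVec (flipDir s) = -unitVec s := by
  rcases s with ⟨i, b⟩
  cases b <;> simp [unitVec, flipDir, Pi.single_neg]

lemma sum_unitVec_neg {d : ℕ} (g : ZLat d → ℝ) :
    ∑ s : Fin d × Bool, g (-unitVec s) = ∑ s : Fin d × Bool, g (unitVec s) := by
  simp_rw [← unitVec_flipDir]
  exact Equiv.sum_comp flipDir (fun s => g (unitVec s))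

section average
variable {d : ℕ}

lemma nbrAverage_mono {g h : ZLat d → ℝ} {y : ZLat d}
    (H : ∀ s, g (y + unitVec s) ≤ h (y + unitVec s)) : nbrAverage g y ≤ nbrAverage h y := by
  unfold nbrAverage
  gcongr
  exact H _

lemma nbrAverage_congr {g h : ZLat d → ℝ} {y : ZLat d}
    (H : ∀ s, g (y + unitVec s) = h (y + unitVec s)) : nbrAverage g y = nbrAverage h y := by
  simp only [nbrAverage, H]

lemma nbrAverage_add (g h : ZLat d → ℝ) : nbrAverage (g + h) = nbrAverage g + nbrAverage h := by
  funext y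
  simp [nbrAverage, Finset.sum_add_distrib, mul_add]

lemma nbrAverage_const_mul (c : ℝ) (h : ZLat d → ℝ) (y : ZLat d) :
    nbrAverage (fun w => c * h w) y = c * nbrAverage h y := by
  simp only [nbrAverage, ← Finset.mul_sum]
  ring

lemma nbrAverage_sub (g h : ZLat d → ℝ) : nbrAverage (g - h) = nbrAverage g - nbrAverage h := by
  funext y
  simp [nbrAverage, Finset.sum_sub_distrib, mul_sub]

lemma nbrAverage_translate (g : ZLat d → ℝ) (w : ZLat d) :
    nbrAverage (fun y => g (w + y)) = fun y => nbrAverage g (w + y) := by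
  funext y
  simp [nbrAverage, add_assoc]

variable [NeZero d]

lemma cast_dim_pos : (0 : ℝ) < d := by exact_mod_cast NeZero.pos d

lemma nbrAverage_const (c : ℝ) : nbrAverage (fun _ : ZLat d => c) = fun _ => c := by
  funext y
  have := cast_dim_pos (d := d)
  simp only [nbrAverage, Finset.sum_const, Finset.card_univ, Fintype.card_prod, Fintype.card_fin,
    Fintype.card_bool, nsmul_eq_mul]
  push_cast
  field_simp

lemma le_nbrAverage_of_forall {g : ZLat d → ℝ} {y : ZLat d} {c : ℝ}
    (H : ∀ s, c ≤ g (y + unitVec s)) : c ≤ nbrAverage g y := by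
  have := nbrAverage_mono (g := fun _ => c) H
  rwa [nbrAverage_const] at this

end average

/-- The transition probability `p_n(0,y)` of the simple random walk, given by its recursion. -/
noncomputable def heatKernel (d : ℕ) : ℕ → ZLat d → ℝ
  | 0 => Pi.single 0 1
  | n + 1 => nbrAverage (heatKernel d n)

section heatKernel
variable {d : ℕ}

lemma heatKernel_nonneg (n : ℕ) (y : ZLat d) : 0 ≤ heatKernel d n y := by
  induction n generalizing y with
  | zero =>
    by_cases h : y = 0
    · subst h; simp [heatKernel]
    · simp [heatKernel, h]
  | succ n ih =>
    simp only [heatKernel, nbrAverage]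
    exact mul_nonneg (by positivity) (Finset.sum_nonneg fun s _ => ih _)

lemma finite_support_nbrAverage {g : ZLat d → ℝ} (hg : g.support.Finite) :
    (nbrAverage g).support.Finite := by
  have : (nbrAverage g).support ⊆ ⋃ s : Fin d × Bool, (fun y => y - unitVec s) '' g.support := by
    intro y hy
    by_contra hc
    apply hy
    have : ∀ s, g (y + unitVec s) = 0 := by
      intro s
      by_contra h
      exact hc (mem_iUnion.2 ⟨s, y + unitVec s, h, by simp⟩)
    simp [nbrAverage, this]
  exact (Set.finite_iUnion fun s => hg.image _).subset this

lemma heatKernel_finite_support (n : ℕ) : (heatKernel d n).support.Finite := by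
  induction n with
  | zero => exact (Set.finite_singleton (0 : ZLat d)).subset (by simp [heatKernel])
  | succ n ih => exact finite_support_nbrAverage ih

lemma tsum_translate (g : ZLat d → ℝ) (a : ZLat d) : ∑' y, g (y + a) = ∑' y, g y :=
  (Equiv.addRight a).tsum_eq g

lemma summable_of_support_subset {g h : ZLat d → ℝ} (hg : g.support.Finite)
    (H : ∀ y, g y = 0 → h y = 0) : Summable h :=
  summable_of_hasFiniteSupport (hg.subset fun y hy hc => hy (H y hc))

lemma finite_support_translate {g : ZLat d → ℝ} (hg : g.support.Finite) (a : ZLat d) :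
    (fun y => g (y + a)).support.Finite :=
  hg.preimage (add_left_injective a).injOn

/-- The averaging operator is self-adjoint on `ℓ²`. -/
lemma tsum_nbrAverage_mul {g : ZLat d → ℝ} (h : ZLat d → ℝ) (hg : g.support.Finite) :
    ∑' y, nbrAverage g y * h y = ∑' y, g y * nbrAverage h y := by
  have e1 : ∀ y, nbrAverage g y * h y =
      ∑ s : Fin d × Bool, (1 / (2 * (d : ℝ))) * (g (y + unitVec s) * h y) := by
    intro y; simp only [nbrAverage, ← Finset.mul_sum, ← Finset.sum_mul]; ring
  have e2 : ∀ y, g y * nbrAverage h y =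
      ∑ s : Fin d × Bool, (1 / (2 * (d : ℝ))) * (g y * h (y + unitVec s)) := by
    intro y; simp only [nbrAverage, ← Finset.mul_sum]; ring
  simp_rw [e1, e2]
  rw [Summable.tsum_finsetSum, Summable.tsum_finsetSum]
  · have : ∀ s : Fin d × Bool, ∑' y, (1 / (2 * (d : ℝ))) * (g (y + unitVec s) * h y) =
        (fun a => ∑' y, (1 / (2 * (d : ℝ))) * (g y * h (y + a))) (-unitVec s) := by
      intro s
      rw [← tsum_translate _ (-unitVec s)]
      simp
    rw [Finset.sum_congr rfl fun s _ => this s,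
      sum_unitVec_neg (fun a => ∑' y, (1 / (2 * (d : ℝ))) * (g y * h (y + a)))]
  · intro s _
    exact summable_of_support_subset hg fun y hy => by simp [hy]
  · intro s _
    exact summable_of_support_subset (finite_support_translate hg (unitVec s))
      fun y hy => mul_eq_zero_of_right _ (mul_eq_zero_of_left hy _)

lemma tsum_heatKernel_mul (n : ℕ) (φ : ZLat d → ℝ) :
    ∑' y, heatKernel d n y * φ y = nbrAverage^[n] φ 0 := by
  induction n generalizing φ with
  | zero =>
    rw [tsum_eq_single 0]
    · simp [heatKernel]
    · intro y hy; simp [heatKernel, hy]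
  | succ n ih =>
    rw [Function.iterate_succ_apply, ← ih]
    exact tsum_nbrAverage_mul φ (heatKernel_finite_support n)

lemma iterate_nbrAverage_heatKernel (n m : ℕ) :
    nbrAverage^[n] (heatKernel d m) = heatKernel d (m + n) := by
  induction n generalizing m with
  | zero => rfl
  | succ n ih =>
    rw [Function.iterate_succ_apply]
    have : nbrAverage (heatKernel d m) = heatKernel d (m + 1) := rfl
    rw [this, ih]
    congr 1
    omega

/-- Chapman–Kolmogorov at the origin. -/
lemma tsum_heatKernel_mul_heatKernel (n m : ℕ) :
    ∑' y, heatKernel d n y * heatKernel d m y = heatKernel d (m + n) 0 := by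
  rw [tsum_heatKernel_mul, iterate_nbrAverage_heatKernel]

end heatKernel

/-! ### The on-diagonal heat kernel bound by Fourier inversion -/

section fourier
variable {d : ℕ}

/-- The normalized Lebesgue measure on `(-π, π]`. -/
noncomputable def circleMeasure : Measure ℝ :=
  ENNReal.ofReal (1 / (2 * Real.pi)) • volume.restrict (Ioc (-Real.pi) Real.pi)

instance : IsProbabilityMeasure circleMeasure := by
  constructor
  have hp := Real.pi_pos
  simp only [circleMeasure, Measure.smul_apply, Measure.restrict_apply MeasurableSet.univ,
    univ_inter, Real.volume_Ioc, smul_eq_mul]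
  rw [← ENNReal.ofReal_mul (by positivity), ← ENNReal.ofReal_one]
  congr 1
  field_simp
  ring

lemma integral_circleMeasure {E : Type*} [NormedAddCommGroup E] [NormedSpace ℝ E] (g : ℝ → E) :
    ∫ t, g t ∂circleMeasure = (1 / (2 * Real.pi)) • ∫ t in (-Real.pi)..Real.pi, g t := by
  have hp := Real.pi_pos
  rw [circleMeasure, integral_smul_measure, intervalIntegral.integral_of_le (by linarith),
    ENNReal.toReal_ofReal (by positivity)]

lemma integral_circle_character (k : ℤ) :
    ∫ t, Complex.exp (Complex.I * (k * t)) ∂circleMeasure = if k = 0 then 1 else 0 := by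
  have hp := Real.pi_pos
  rw [integral_circleMeasure]
  split_ifs with h
  · subst h
    simp
    field_simp
    norm_num
  · have hk : (Complex.I * k) ≠ 0 := by simp [h]
    simp_rw [← mul_assoc]
    rw [integral_exp_mul_complex hk]
    have : Complex.exp (Complex.I * k * (Real.pi : ℝ)) =
        Complex.exp (Complex.I * k * ((-Real.pi : ℝ))) := by
      rw [Complex.exp_eq_exp_iff_exists_int]
      exact ⟨k, by push_cast; ring⟩
    rw [this]
    simp

/-- The product measure on the torus. -/
noncomputable def torusMeasure (d : ℕ) : Measure (Fin d → ℝ) :=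
  Measure.pi fun _ => circleMeasure

instance : IsProbabilityMeasure (torusMeasure d) := by unfold torusMeasure; infer_instance

/-- The characteristic function of one step of the walk. -/
noncomputable def stepChar (θ : Fin d → ℝ) : ℝ := (1 / (d : ℝ)) * ∑ i, Real.cos (θ i)

lemma continuous_stepChar : Continuous (stepChar (d := d)) := by
  unfold stepChar; fun_prop

lemma abs_stepChar_le_one [NeZero d] (θ : Fin d → ℝ) : |stepChar θ| ≤ 1 := by
  have hd := cast_dim_pos (d := d)
  rw [stepChar, abs_mul, abs_of_pos (by positivity)]
  calc 1 / (d : ℝ) * |∑ i, Real.cos (θ i)| ≤ 1 / (d : ℝ) * ∑ i : Fin d, (1 : ℝ) := by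
        gcongr
        exact (Finset.abs_sum_le_sum_abs _ _).trans
          (Finset.sum_le_sum fun i _ => Real.abs_cos_le_one _)
    _ = 1 := by simp

lemma nbrAverage_cos [NeZero d] (θ : Fin d → ℝ) (y : ZLat d) :
    nbrAverage (fun y => Real.cos (∑ i, (y i : ℝ) * θ i)) y =
      stepChar θ * Real.cos (∑ i, (y i : ℝ) * θ i) := by
  have hd := cast_dim_pos (d := d)
  have key : ∀ (j : Fin d) (b : Bool), ∑ i, ((y + unitVec (j, b)) i : ℝ) * θ i =
      (∑ i, (y i : ℝ) * θ i) + (if b then 1 else -1) * θ j := by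
    intro j b
    simp only [Pi.add_apply, Int.cast_add, add_mul, Finset.sum_add_distrib]
    congr 1
    rw [Finset.sum_eq_single j]
    · cases b <;> simp [unitVec]
    · intro i _ hi
      simp [unitVec, hi]
    · simp
  simp only [nbrAverage, Fintype.sum_prod_type, Fintype.sum_bool, key, stepChar]
  rw [Finset.mul_sum, Finset.mul_sum, Finset.sum_mul]
  refine Finset.sum_congr rfl fun j _ => ?_
  simp only [if_true, Bool.false_eq_true, if_false, one_mul, neg_mul]
  rw [Real.cos_add, ← sub_eq_add_neg, Real.cos_sub]
  field_simp
  ring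

lemma integrable_stepChar_mul_cos [NeZero d] (n : ℕ) (y : ZLat d) :
    Integrable (fun θ => stepChar θ ^ n * Real.cos (∑ i, (y i : ℝ) * θ i)) (torusMeasure d) := by
  refine Integrable.of_bound (C := 1) ?_ (ae_of_all _ fun θ => ?_)
  · exact (((continuous_stepChar.pow n).mul (Real.continuous_cos.comp
      (by fun_prop)))).aestronglyMeasurable
  · rw [Real.norm_eq_abs, abs_mul, abs_pow]
    exact mul_le_one₀ (pow_le_one₀ (abs_nonneg _) (abs_stepChar_le_one θ)) (abs_nonneg _)
      (Real.abs_cos_le_one _)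

/-- Fourier inversion for the simple random walk. -/
lemma heatKernel_eq_integral [NeZero d] (n : ℕ) (y : ZLat d) :
    heatKernel d n y =
      ∫ θ, stepChar θ ^ n * Real.cos (∑ i, (y i : ℝ) * θ i) ∂torusMeasure d := by
  induction n generalizing y with
  | zero =>
    have h1 : ∀ θ : Fin d → ℝ, Real.cos (∑ i, (y i : ℝ) * θ i) =
        RCLike.re (∏ i, Complex.exp (Complex.I * ((y i : ℤ) * (θ i : ℝ)))) := by
      intro θ
      rw [← Complex.exp_sum, ← Finset.mul_sum, mul_comm]
      have : (∑ i, ((y i : ℤ) : ℂ) * ((θ i : ℝ) : ℂ)) = ((∑ i, (y i : ℝ) * θ i : ℝ) : ℂ) := by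
        push_cast; rfl
      rw [this]
      exact (Complex.exp_ofReal_mul_I_re _).symm
    simp only [pow_zero, one_mul, h1]
    rw [integral_re]
    · rw [torusMeasure, integral_fintype_prod_eq_prod (𝕜 := ℂ)
        (f := fun i (t : ℝ) => Complex.exp (Complex.I * ((y i : ℤ) * t)))]
      simp only [integral_circle_character]
      by_cases h : y = 0
      · subst h; simp [heatKernel]
      · obtain ⟨i, hi⟩ := Function.ne_iff.1 h
        rw [Finset.prod_eq_zero (Finset.mem_univ i) (if_neg hi)]
        simp [heatKernel, h]
    · refine Integrable.of_bound (C := 1) ?_ (ae_of_all _ fun θ => ?_)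
      · exact (Continuous.aestronglyMeasurable (by fun_prop))
      · rw [norm_prod]
        refine (Finset.prod_le_one (fun _ _ => norm_nonneg _) fun i _ => ?_)
        rw [mul_comm]
        have : ((y i : ℤ) : ℂ) * ((θ i : ℝ) : ℂ) = (((y i : ℝ) * θ i : ℝ) : ℂ) := by push_cast; rfl
        rw [this, Complex.norm_exp_ofReal_mul_I]
  | succ n ih =>
    simp only [heatKernel]
    have : nbrAverage (heatKernel d n) y = ∫ θ, nbrAverage (fun w =>
        stepChar θ ^ n * Real.cos (∑ i, (w i : ℝ) * θ i)) y ∂torusMeasure d := by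
      simp only [nbrAverage]
      rw [integral_const_mul, integral_finsetSum _ fun s _ => integrable_stepChar_mul_cos n _]
      simp only [ih]
    rw [this]
    congr 1
    funext θ
    rw [nbrAverage_const_mul, nbrAverage_cos]
    ring

lemma abs_stepChar_pow_le [NeZero d] (n : ℕ) (θ : Fin d → ℝ) :
    |stepChar θ| ^ n ≤ ∏ i, Real.exp (-(n / (2 * d)) * Real.sin (θ i) ^ 2) := by
  have hd := cast_dim_pos (d := d)
  have hcos : ∀ t : ℝ, |Real.cos t| ≤ 1 - Real.sin t ^ 2 / 2 := by
    intro t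
    refine abs_le_of_sq_le_sq ?_ ?_
    · nlinarith [Real.sin_sq_add_cos_sq t, sq_nonneg (Real.sin t ^ 2)]
    · nlinarith [Real.sin_sq_add_cos_sq t, sq_nonneg (Real.cos t)]
  have h1 : |stepChar θ| ≤ Real.exp (-(∑ i, Real.sin (θ i) ^ 2) / (2 * d)) := by
    calc |stepChar θ| ≤ 1 / (d : ℝ) * ∑ i, |Real.cos (θ i)| := by
          rw [stepChar, abs_mul, abs_of_pos (by positivity)]
          gcongr
          exact Finset.abs_sum_le_sum_abs _ _
      _ ≤ 1 / (d : ℝ) * ∑ i, (1 - Real.sin (θ i) ^ 2 / 2) := by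
          gcongr with i
          exact hcos _
      _ = -(∑ i, Real.sin (θ i) ^ 2) / (2 * d) + 1 := by
          rw [Finset.sum_sub_distrib, ← Finset.sum_div]
          simp
          field_simp
          ring
      _ ≤ _ := Real.add_one_le_exp _
  calc |stepChar θ| ^ n ≤ Real.exp (-(∑ i, Real.sin (θ i) ^ 2) / (2 * d)) ^ n := by gcongr
    _ = _ := by
      rw [← Real.exp_sum, ← Real.exp_nat_mul, ← Finset.mul_sum]
      congr 1
      ring

lemma exp_sin_sq_le {a t : ℝ} (ha : 0 ≤ a) (ht : t ∈ Icc (-Real.pi) Real.pi) :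
    Real.exp (-a * Real.sin t ^ 2) ≤ Real.exp (-(a * (4 / Real.pi ^ 2)) * t ^ 2) +
      Real.exp (-(a * (4 / Real.pi ^ 2)) * (t - Real.pi) ^ 2) +
      Real.exp (-(a * (4 / Real.pi ^ 2)) * (t + Real.pi) ^ 2) := by
  have hp := Real.pi_pos
  have key : ∀ x : ℝ, |x| ≤ Real.pi / 2 → Real.sin x ^ 2 = Real.sin t ^ 2 →
      Real.exp (-a * Real.sin t ^ 2) ≤ Real.exp (-(a * (4 / Real.pi ^ 2)) * x ^ 2) := by
    intro x hx hs
    rw [← hs]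
    apply Real.exp_le_exp.2
    have h1 := Real.mul_le_sin (abs_nonneg x) hx
    have h2 : (2 / Real.pi * |x|) ^ 2 ≤ Real.sin |x| ^ 2 := by gcongr
    have h3 : Real.sin |x| ^ 2 = Real.sin x ^ 2 := by
      rcases abs_choice x with h | h <;> simp [h]
    rw [h3, mul_pow, sq_abs] at h2
    have h4 : (2 / Real.pi) ^ 2 = 4 / Real.pi ^ 2 := by ring
    rw [h4] at h2
    nlinarith
  have e1 := (Real.exp_pos (-(a * (4 / Real.pi ^ 2)) * t ^ 2)).le
  have e2 := (Real.exp_pos (-(a * (4 / Real.pi ^ 2)) * (t - Real.pi) ^ 2)).le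
  have e3 := (Real.exp_pos (-(a * (4 / Real.pi ^ 2)) * (t + Real.pi) ^ 2)).le
  obtain ⟨h1, h2⟩ := ht
  by_cases c1 : t ≤ Real.pi / 2
  · by_cases c2 : -(Real.pi / 2) ≤ t
    · have := key t (abs_le.2 ⟨c2, c1⟩) rfl
      linarith
    · have := key (t + Real.pi) (abs_le.2 ⟨by linarith, by linarith⟩) (by simp [Real.sin_add_pi])
      linarith
  · have := key (t - Real.pi) (abs_le.2 ⟨by linarith, by linarith⟩) (by simp [Real.sin_sub_pi])
    linarith

lemma integral_circle_exp_sin_sq_le {a : ℝ} (ha : 0 < a) :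
    ∫ t, Real.exp (-a * Real.sin t ^ 2) ∂circleMeasure ≤
      (1 / (2 * Real.pi)) * (3 * √(Real.pi / (a * (4 / Real.pi ^ 2)))) := by
  have hp := Real.pi_pos
  set b := a * (4 / Real.pi ^ 2) with hb
  have hb0 : 0 < b := by positivity
  have i1 := integrable_exp_neg_mul_sq hb0
  have i2 : Integrable fun t : ℝ => Real.exp (-b * (t - Real.pi) ^ 2) := i1.comp_sub_right Real.pi
  have i3 : Integrable fun t : ℝ => Real.exp (-b * (t + Real.pi) ^ 2) := i1.comp_add_right Real.pi
  rw [integral_circleMeasure, smul_eq_mul, intervalIntegral.integral_of_le (by linarith)]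
  gcongr
  calc ∫ t in Ioc (-Real.pi) Real.pi, Real.exp (-a * Real.sin t ^ 2)
      ≤ ∫ t in Ioc (-Real.pi) Real.pi, (Real.exp (-b * t ^ 2) +
          Real.exp (-b * (t - Real.pi) ^ 2) + Real.exp (-b * (t + Real.pi) ^ 2)) := by
        refine setIntegral_mono_on ?_ ((i1.add i2).add i3).integrableOn measurableSet_Ioc ?_
        · exact (Continuous.integrableOn_Icc (by fun_prop)).mono_set Ioc_subset_Icc_self
        · intro t ht
          exact exp_sin_sq_le ha.le (Ioc_subset_Icc_self ht)
    _ ≤ ∫ t : ℝ, (Real.exp (-b * t ^ 2) +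
          Real.exp (-b * (t - Real.pi) ^ 2) + Real.exp (-b * (t + Real.pi) ^ 2)) := by
        refine setIntegral_le_integral ((i1.add i2).add i3) (ae_of_all _ fun t => ?_)
        simp only [Pi.zero_apply]
        positivity
    _ = 3 * √(Real.pi / b) := by
        rw [integral_add (by exact i1.add i2) i3, integral_add i1 i2,
          integral_sub_right_eq_self (fun t => Real.exp (-b * t ^ 2)),
          integral_add_right_eq_self (fun t => Real.exp (-b * t ^ 2)), integral_gaussian]
        ring

/-- The heat kernel decays like `n^{-d/2}`. -/
theorem exists_heatKernel_le (d : ℕ) [NeZero d] : ∃ A : ℝ, 0 < A ∧ ∀ n : ℕ, 0 < n → ∀ y : ZLat d,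
    heatKernel d n y ≤ A * (n : ℝ) ^ (-((d : ℝ) / 2)) := by
  have hp := Real.pi_pos
  have hd := cast_dim_pos (d := d)
  set A₁ : ℝ := (1 / (2 * Real.pi)) * (3 * √(Real.pi * (2 * d) / (4 / Real.pi ^ 2))) with hA
  refine ⟨A₁ ^ d, by positivity, fun n hn y => ?_⟩
  have hn' : (0 : ℝ) < n := by exact_mod_cast hn
  rw [heatKernel_eq_integral]
  calc ∫ θ, stepChar θ ^ n * Real.cos (∑ i, (y i : ℝ) * θ i) ∂torusMeasure d
      ≤ ∫ θ, ∏ i, Real.exp (-(n / (2 * d)) * Real.sin (θ i) ^ 2) ∂torusMeasure d := by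
        refine integral_mono (integrable_stepChar_mul_cos n y) ?_ fun θ => ?_
        · refine Integrable.of_bound (C := 1)
            (Continuous.aestronglyMeasurable (by fun_prop)) (ae_of_all _ fun θ => ?_)
          rw [Real.norm_eq_abs, Finset.abs_prod]
          refine Finset.prod_le_one (fun _ _ => abs_nonneg _) fun i _ => ?_
          rw [Real.abs_exp]
          apply Real.exp_le_one_iff.2
          have : 0 ≤ (n / (2 * d) : ℝ) * Real.sin (θ i) ^ 2 := by positivity
          linarith
        · refine le_trans (le_abs_self _) ?_
          rw [abs_mul, abs_pow]
          refine le_trans ?_ (abs_stepChar_pow_le n θ)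
          exact mul_le_of_le_one_right (by positivity) (Real.abs_cos_le_one _)
    _ = (∫ t, Real.exp (-(n / (2 * d)) * Real.sin t ^ 2) ∂circleMeasure) ^ d := by
        rw [torusMeasure, integral_fintype_prod_eq_prod (𝕜 := ℝ)
          (f := fun _ (t : ℝ) => Real.exp (-(n / (2 * d)) * Real.sin t ^ 2))]
        simp
    _ ≤ (A₁ * (n : ℝ) ^ (-(1 / 2) : ℝ)) ^ d := by
        refine pow_le_pow_left₀ (integral_nonneg fun t => (Real.exp_pos _).le) ?_ d
        refine (integral_circle_exp_sin_sq_le (by positivity)).trans (le_of_eq ?_)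
        have : Real.pi / ((n : ℝ) / (2 * d) * (4 / Real.pi ^ 2)) =
            (Real.pi * (2 * d) / (4 / Real.pi ^ 2)) * (n : ℝ)⁻¹ := by field_simp
        rw [this, Real.sqrt_mul (by positivity), hA, Real.sqrt_inv, Real.rpow_neg hn'.le,
          ← Real.sqrt_eq_rpow]
        ring
    _ = _ := by
        rw [mul_pow, ← Real.rpow_natCast, ← Real.rpow_natCast, ← Real.rpow_mul hn'.le]
        congr 2
        ring

/-- Heat kernel tails, with a suboptimal exponent that still grows linearly in `d`. -/
theorem exists_heatKernel_tail_le (d : ℕ) [NeZero d] (hd : 3 ≤ d) : ∃ A : ℝ, 0 < A ∧ ∀ m N : ℕ,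
    0 < m → ∀ y : ZLat d, ∑ n ∈ Finset.range N, heatKernel d (m + n) y ≤
      A * (m : ℝ) ^ (-((d : ℝ) / 2 - 5 / 4)) := by
  obtain ⟨A, hA, h⟩ := exists_heatKernel_le d
  have hd' : (3 : ℝ) ≤ d := by exact_mod_cast hd
  have hs : Summable fun n : ℕ => (n : ℝ) ^ (-(5 / 4) : ℝ) :=
    Real.summable_nat_rpow.2 (by norm_num)
  have hs0 : 0 ≤ ∑' n : ℕ, (n : ℝ) ^ (-(5 / 4) : ℝ) := tsum_nonneg fun n => by positivity
  refine ⟨A * (1 + ∑' n : ℕ, (n : ℝ) ^ (-(5 / 4) : ℝ)), by positivity, fun m N hm y => ?_⟩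
  have hm' : (0 : ℝ) < m := by exact_mod_cast hm
  calc ∑ n ∈ Finset.range N, heatKernel d (m + n) y
      ≤ ∑ n ∈ Finset.range N, A * (m : ℝ) ^ (-((d : ℝ) / 2 - 5 / 4)) *
          ((n + m : ℕ) : ℝ) ^ (-(5 / 4) : ℝ) := by
        refine Finset.sum_le_sum fun n _ => (h (m + n) (by omega) y).trans ?_
        have hmn : (m : ℝ) ≤ ((m + n : ℕ) : ℝ) := by push_cast; linarith [n.cast_nonneg (α := ℝ)]
        have hpos : (0 : ℝ) < ((m + n : ℕ) : ℝ) := by linarith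
        have : -((d : ℝ) / 2) = -((d : ℝ) / 2 - 5 / 4) + (-(5 / 4)) := by ring
        rw [this, Real.rpow_add hpos, add_comm n m, ← mul_assoc]
        gcongr ?_ * _
        gcongr A * ?_
        exact Real.rpow_le_rpow_of_nonpos hm' hmn (by linarith)
    _ = A * (m : ℝ) ^ (-((d : ℝ) / 2 - 5 / 4)) *
          ∑ n ∈ Finset.range N, ((n + m : ℕ) : ℝ) ^ (-(5 / 4) : ℝ) := by rw [Finset.mul_sum]
    _ ≤ A * (m : ℝ) ^ (-((d : ℝ) / 2 - 5 / 4)) * (1 + ∑' n : ℕ, (n : ℝ) ^ (-(5 / 4) : ℝ)) := by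
        gcongr
        have h1 := ((summable_nat_add_iff m).2 hs).sum_le_tsum (Finset.range N)
          fun n _ => by positivity
        have h2 := hs.sum_add_tsum_nat_add m
        have h3 : 0 ≤ ∑ n ∈ Finset.range m, (n : ℝ) ^ (-(5 / 4) : ℝ) :=
          Finset.sum_nonneg fun n _ => by positivity
        linarith
    _ = _ := by ring

end fourier

/-! ### Dirichlet forms and pointwise bounds on equilibrium potentials -/

section energy
variable {d : ℕ}

/-- Summation by parts for the conductances `f(y) f(y+s)`. -/
lemma tsum_mul_conductance_diff (f a b : ZLat d → ℝ) (hb : b.support.Finite) :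
    ∑' y, b y * ∑ s : Fin d × Bool, f y * f (y + unitVec s) * (a y - a (y + unitVec s)) =
      (1 / 2) * ∑' y, ∑ s : Fin d × Bool, f y * f (y + unitVec s) *
        ((a y - a (y + unitVec s)) * (b y - b (y + unitVec s))) := by
  set F : ZLat d → ZLat d → ℝ := fun e y => b y * (f y * f (y + e) * (a y - a (y + e))) with hF
  set H : ZLat d → ZLat d → ℝ :=
    fun e y => b (y + e) * (f y * f (y + e) * (a y - a (y + e))) with hH
  have sF : ∀ e, Summable (F e) := fun e =>
    summable_of_support_subset hb fun y hy => by simp [hF, hy]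
  have sH : ∀ e, Summable (H e) := fun e =>
    summable_of_support_subset (finite_support_translate hb e)
      fun y hy => mul_eq_zero_of_left hy _
  have hHF : ∀ e, ∑' y, H e y = -∑' y, F (-e) y := by
    intro e
    rw [← tsum_translate (F (-e)) e, ← tsum_neg]
    congr 1
    funext y
    simp only [hF, hH, add_neg_cancel_right]
    ring
  have e1 : ∀ y, ∑ s : Fin d × Bool, f y * f (y + unitVec s) *
      ((a y - a (y + unitVec s)) * (b y - b (y + unitVec s))) =
      ∑ s : Fin d × Bool, (F (unitVec s) y - H (unitVec s) y) := by
    intro y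
    refine Finset.sum_congr rfl fun s _ => ?_
    simp only [hF, hH]
    ring
  simp_rw [e1, Finset.mul_sum]
  rw [Summable.tsum_finsetSum fun s _ => (sF _).sub (sH _), Summable.tsum_finsetSum fun s _ => sF _]
  simp_rw [fun s : Fin d × Bool => (sF (unitVec s)).tsum_sub (sH (unitVec s)), hHF]
  rw [Finset.sum_sub_distrib, Finset.sum_neg_distrib,
    sum_unitVec_neg fun e => ∑' y, F e y]
  ring

lemma sum_sub_unitVec [NeZero d] (a : ZLat d → ℝ) (y : ZLat d) :
    ∑ s : Fin d × Bool, (a y - a (y + unitVec s)) = 2 * d * (a y - nbrAverage a y) := by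
  have := cast_dim_pos (d := d)
  simp only [Finset.sum_sub_distrib, nbrAverage, Finset.sum_const, Finset.card_univ,
    Fintype.card_prod, Fintype.card_fin, Fintype.card_bool, nsmul_eq_mul]
  push_cast
  field_simp

lemma tsum_mul_sub_nbrAverage [NeZero d] (a b : ZLat d → ℝ) (hb : b.support.Finite) :
    2 * d * ∑' y, b y * (a y - nbrAverage a y) =
      (1 / 2) * ∑' y, ∑ s : Fin d × Bool,
        ((a y - a (y + unitVec s)) * (b y - b (y + unitVec s))) := by
  have := tsum_mul_conductance_diff (fun _ => 1) a b hb
  simp only [one_mul, sum_sub_unitVec] at this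
  rw [← this, ← tsum_mul_left]
  congr 1
  funext y
  ring

lemma summable_sum_diff {b : ZLat d → ℝ} (hb : b.support.Finite)
    (H : ZLat d → Fin d × Bool → ℝ)
    (h : ∀ y s, b y = 0 → b (y + unitVec s) = 0 → H y s = 0) :
    Summable fun y => ∑ s, H y s := by
  refine summable_sum fun s _ => ?_
  refine summable_of_hasFiniteSupport ((hb.union (finite_support_translate hb (unitVec s))).subset ?_)
  intro y hy
  by_contra hc
  simp only [mem_union, not_or, Function.mem_support, not_not] at hc
  exact hy (h y s hc.1 hc.2)

/-- Cauchy–Schwarz for the Dirichlet form, in additive form. -/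
lemma dirichlet_form_le [NeZero d] (a b : ZLat d → ℝ) (ha : a.support.Finite)
    (hb : b.support.Finite) {l : ℝ} (hl : 0 < l) :
    ∑' y, b y * (a y - nbrAverage a y) ≤
      (1 / 2) * (l * ∑' y, a y * (a y - nbrAverage a y) +
        l⁻¹ * ∑' y, b y * (b y - nbrAverage b y)) := by
  have hd := cast_dim_pos (d := d)
  have sab := summable_sum_diff hb
    (fun y s => (a y - a (y + unitVec s)) * (b y - b (y + unitVec s)))
    fun y s h1 h2 => by simp [h1, h2]
  have saa := summable_sum_diff ha
    (fun y s => (a y - a (y + unitVec s)) * (a y - a (y + unitVec s)))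
    fun y s h1 h2 => by simp [h1, h2]
  have sbb := summable_sum_diff hb
    (fun y s => (b y - b (y + unitVec s)) * (b y - b (y + unitVec s)))
    fun y s h1 h2 => by simp [h1, h2]
  have h1 := tsum_mul_sub_nbrAverage a b hb
  have h2 := tsum_mul_sub_nbrAverage a a ha
  have h3 := tsum_mul_sub_nbrAverage b b hb
  have key := Summable.tsum_le_tsum (fun y => ?_) sab
    (((saa.mul_left l).add (sbb.mul_left l⁻¹)).mul_left (1 / 2))
  · rw [tsum_mul_left, (saa.mul_left l).tsum_add (sbb.mul_left l⁻¹), tsum_mul_left,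
      tsum_mul_left] at key
    refine le_of_mul_le_mul_left ?_ (show (0 : ℝ) < 2 * d by positivity)
    calc _ = _ := h1
      _ ≤ _ := mul_le_mul_of_nonneg_left key (by norm_num)
      _ = (1 / 2) * (l * (2 * d * ∑' y, a y * (a y - nbrAverage a y)) +
        l⁻¹ * (2 * d * ∑' y, b y * (b y - nbrAverage b y))) := by rw [h2, h3]; ring
      _ = _ := by ring
  · rw [Finset.mul_sum, Finset.mul_sum, ← Finset.sum_add_distrib, Finset.mul_sum]
    refine Finset.sum_le_sum fun s _ => ?_
    set p := a y - a (y + unitVec s)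
    set q := b y - b (y + unitVec s)
    have e : (1 / 2) * (l * (p * p) + l⁻¹ * (q * q)) - p * q = l⁻¹ / 2 * (l * p - q) ^ 2 := by
      field_simp
      ring
    have : 0 ≤ l⁻¹ / 2 * (l * p - q) ^ 2 := by positivity
    linarith

/-- The truncation `(φ-η)⁺` of the equilibrium potential of `K` for the conductances
`f(y) f(y+s)` has Dirichlet energy at most of the order of `|K|`. -/
lemma energy_truncation_le [NeZero d] {f φ : ZLat d → ℝ} {K : Set (ZLat d)} (hK : K.Finite)
    {c C : ℝ} (hc : 0 < c) (hf : ∀ y, c ≤ f y ∧ f y ≤ C) (hφ : ∀ y, 0 ≤ φ y ∧ φ y ≤ 1)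
    (harm : ∀ y ∉ K, ∑ s : Fin d × Bool, f y * f (y + unitVec s) * (φ y - φ (y + unitVec s)) = 0)
    {η : ℝ} (hη : 0 ≤ η) {ψ : ZLat d → ℝ} (hψ : ∀ y, ψ y = max (φ y - η) 0)
    (hfin : ψ.support.Finite) :
    ∑' y, ψ y * (ψ y - nbrAverage ψ y) ≤ C ^ 2 / c ^ 2 * K.ncard := by
  have hd := cast_dim_pos (d := d)
  have hC : 0 < C := hc.trans_le ((hf 0).1.trans (hf 0).2)
  have s1 := summable_sum_diff hfin
    (fun y s => (ψ y - ψ (y + unitVec s)) * (ψ y - ψ (y + unitVec s)))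
    fun y s h1 h2 => by simp [h1, h2]
  have s2 := summable_sum_diff hfin
    (fun y s => f y * f (y + unitVec s) * ((φ y - φ (y + unitVec s)) * (ψ y - ψ (y + unitVec s))))
    fun y s h1 h2 => by simp [h1, h2]
  -- truncation is a contraction, and the conductances are at least `c ^ 2`
  have key := Summable.tsum_le_tsum (fun y => ?_) (s1.mul_left (c ^ 2)) s2
  · have e1 := tsum_mul_sub_nbrAverage ψ ψ hfin
    have e2 := tsum_mul_conductance_diff f φ ψ hfin
    have bound : ∑' y, ψ y * ∑ s : Fin d × Bool, f y * f (y + unitVec s) *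
        (φ y - φ (y + unitVec s)) ≤ 2 * d * (C ^ 2 * K.ncard) := by
      rw [tsum_eq_sum (s := hK.toFinset) fun y hy => by
        rw [harm y (by simpa using hy), mul_zero], Set.ncard_eq_toFinset_card K hK]
      calc _ ≤ ∑ y ∈ hK.toFinset, 2 * d * C ^ 2 := by
            refine Finset.sum_le_sum fun y _ => ?_
            have hs : ∑ s : Fin d × Bool, f y * f (y + unitVec s) * (φ y - φ (y + unitVec s)) ≤
                ∑ s : Fin d × Bool, C * C := by
              refine Finset.sum_le_sum fun s _ => ?_
              have h1 := hf y
              have h2 := hf (y + unitVec s)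
              have h3 : φ y - φ (y + unitVec s) ≤ 1 := by
                linarith [(hφ y).2, (hφ (y + unitVec s)).1]
              calc _ ≤ f y * f (y + unitVec s) * 1 :=
                    mul_le_mul_of_nonneg_left h3 (mul_nonneg (hc.le.trans h1.1) (hc.le.trans h2.1))
                _ ≤ C * C := by
                    rw [mul_one]
                    exact mul_le_mul h1.2 h2.2 (hc.le.trans h2.1) hC.le
            have hψ0 : 0 ≤ ψ y := by rw [hψ]; exact le_max_right _ _
            have hψ1 : ψ y ≤ 1 := by
              rw [hψ]; exact max_le (by linarith [(hφ y).2]) zero_le_one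
            calc _ ≤ ψ y * ∑ s : Fin d × Bool, C * C := mul_le_mul_of_nonneg_left hs hψ0
              _ ≤ 1 * ∑ s : Fin d × Bool, C * C := by gcongr
              _ = _ := by simp; ring
        _ = _ := by rw [Finset.sum_const, nsmul_eq_mul]; ring
    rw [tsum_mul_left] at key
    have h1 : c ^ 2 * (2 * d * ∑' y, ψ y * (ψ y - nbrAverage ψ y)) ≤ 2 * d * (C ^ 2 * K.ncard) := by
      rw [e1]; rw [e2] at bound; linarith
    rw [div_mul_eq_mul_div, le_div_iff₀ (by positivity)]
    refine le_of_mul_le_mul_left ?_ (show (0 : ℝ) < 2 * d by positivity)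
    linarith
  · rw [Finset.mul_sum]
    refine Finset.sum_le_sum fun s _ => ?_
    have hm : (ψ y - ψ (y + unitVec s)) * (ψ y - ψ (y + unitVec s)) ≤
        (φ y - φ (y + unitVec s)) * (ψ y - ψ (y + unitVec s)) := by
      rw [hψ, hψ]
      rcases le_total (φ y - η) 0 with h1 | h1 <;>
        rcases le_total (φ (y + unitVec s) - η) 0 with h2 | h2 <;>
        simp only [max_eq_left, max_eq_right, h1, h2] <;> nlinarith
    have h0 : 0 ≤ (ψ y - ψ (y + unitVec s)) * (ψ y - ψ (y + unitVec s)) := mul_self_nonneg _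
    have h1 := hf y
    have h2 := hf (y + unitVec s)
    have h3 : c ^ 2 ≤ f y * f (y + unitVec s) := by
      rw [sq]; exact mul_le_mul h1.1 h2.1 hc.le (hc.le.trans h1.1)
    calc _ ≤ f y * f (y + unitVec s) * ((ψ y - ψ (y + unitVec s)) * (ψ y - ψ (y + unitVec s))) :=
          mul_le_mul_of_nonneg_right h3 h0
      _ ≤ _ := mul_le_mul_of_nonneg_left hm ((sq_nonneg c).trans h3)

/-- Averages of a finitely supported function against the heat kernel at time `t` are controlled
by its Dirichlet energy and by the Green function after time `2t`. -/
lemma tsum_heatKernel_mul_le_energy [NeZero d] (hd : 3 ≤ d) {ψ : ZLat d → ℝ}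
    (hfin : ψ.support.Finite) {B : ℝ} {t : ℕ}
    (hB : ∀ N, ∑ n ∈ Finset.range N, heatKernel d (t + t + n) 0 ≤ B) {l : ℝ} (hl : 0 < l) :
    ∑' y, heatKernel d t y * ψ y ≤
      (1 / 2) * (l * B + l⁻¹ * ∑' y, ψ y * (ψ y - nbrAverage ψ y)) := by
  have supp : ∀ n, Summable fun y => heatKernel d n y * ψ y := fun n =>
    summable_of_support_subset hfin fun y hy => by simp [hy]
  -- `γ N = ∑_{n < N} p_{t+n}` is a truncated Green function
  set γ : ℕ → ZLat d → ℝ := fun N y => ∑ n ∈ Finset.range N, heatKernel d (t + n) y with hγ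
  have hγfin : ∀ N, (γ N).support.Finite := by
    intro N
    refine (Set.Finite.biUnion (Finset.range N).finite_toSet
      fun n _ => heatKernel_finite_support (d := d) (t + n)).subset ?_
    intro y hy
    obtain ⟨n, hn, h⟩ := Finset.exists_ne_zero_of_sum_ne_zero hy
    exact mem_biUnion hn h
  have hγavg : ∀ N y, γ N y - nbrAverage (γ N) y = heatKernel d t y - heatKernel d (t + N) y := by
    intro N y
    have : nbrAverage (γ N) y = ∑ n ∈ Finset.range N, heatKernel d (t + (n + 1)) y := by
      simp only [hγ, nbrAverage, Finset.mul_sum]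
      rw [Finset.sum_comm]
      refine Finset.sum_congr rfl fun n _ => ?_
      rw [← Finset.mul_sum]
      rfl
    rw [this]
    simp only [hγ, ← Finset.sum_sub_distrib]
    rw [Finset.sum_range_sub' fun n => heatKernel d (t + n) y]
    simp
  have hγγ : ∀ N, ∑' y, γ N y * (γ N y - nbrAverage (γ N) y) ≤ B := by
    intro N
    refine le_trans ?_ (hB N)
    have sγ : Summable fun y => γ N y * heatKernel d t y :=
      summable_of_support_subset (hγfin N) fun y hy => by rw [hy, zero_mul]
    calc _ ≤ ∑' y, γ N y * heatKernel d t y := by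
          refine Summable.tsum_le_tsum (fun y => ?_)
            (summable_of_support_subset (hγfin N) fun y hy => by rw [hy, zero_mul]) sγ
          rw [hγavg]
          exact mul_le_mul_of_nonneg_left (by linarith [heatKernel_nonneg (d := d) (t + N) y])
            (Finset.sum_nonneg fun n _ => heatKernel_nonneg _ _)
      _ = ∑ n ∈ Finset.range N, heatKernel d (t + t + n) 0 := by
          simp only [hγ, Finset.sum_mul]
          rw [Summable.tsum_finsetSum fun n _ => summable_of_support_subset
            (heatKernel_finite_support (d := d) (t + n)) fun y hy => by rw [hy, zero_mul]]
          refine Finset.sum_congr rfl fun n _ => ?_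
          rw [tsum_heatKernel_mul_heatKernel, add_assoc]
      _ ≤ _ := le_rfl
  have main : ∀ N, ∑' y, heatKernel d t y * ψ y - ∑' y, heatKernel d (t + N) y * ψ y ≤
      (1 / 2) * (l * B + l⁻¹ * ∑' y, ψ y * (ψ y - nbrAverage ψ y)) := by
    intro N
    rw [← (supp _).tsum_sub (supp _)]
    calc _ = ∑' y, ψ y * (γ N y - nbrAverage (γ N) y) := by
          congr 1; funext y; rw [hγavg]; ring
      _ ≤ _ := dirichlet_form_le (γ N) ψ (hγfin N) hfin hl
      _ ≤ _ := by gcongr; exact hγγ N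
  have lim : Filter.Tendsto (fun N => ∑' y, heatKernel d (t + N) y * ψ y) Filter.atTop (nhds 0) := by
    have : ∀ N, ∑' y, heatKernel d (t + N) y * ψ y =
        ∑ y ∈ hfin.toFinset, heatKernel d (t + N) y * ψ y := fun N =>
      tsum_eq_sum fun y hy => by
        have : ψ y = 0 := by simpa using hy
        simp [this]
    simp_rw [this]
    rw [← Finset.sum_const_zero (s := hfin.toFinset) (M := ℝ)]
    refine tendsto_finsetSum _ fun y _ => ?_
    rw [← zero_mul (ψ y)]
    refine Filter.Tendsto.mul_const _ ?_
    obtain ⟨A, hA, h⟩ := exists_heatKernel_le d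
    have hd' : (3 : ℝ) ≤ d := by exact_mod_cast hd
    have h1 : Filter.Tendsto (fun n : ℕ => heatKernel d n y) Filter.atTop (nhds 0) := by
      refine tendsto_of_tendsto_of_tendsto_of_le_of_le' tendsto_const_nhds ?_
        (Filter.Eventually.of_forall fun n => heatKernel_nonneg n y)
        (Filter.eventually_atTop.2 ⟨1, fun n hn => h n (by omega) y⟩)
      have := (tendsto_rpow_neg_atTop (y := (d : ℝ) / 2) (by linarith)).comp
        (tendsto_natCast_atTop_atTop (R := ℝ))
      simpa using this.const_mul A
    exact h1.comp (Filter.tendsto_atTop_mono (fun N => Nat.le_add_left N t) Filter.tendsto_id)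
  have := lim.const_sub (∑' y, heatKernel d t y * ψ y)
  rw [sub_zero] at this
  exact le_of_tendsto' this main

lemma eucNorm_sq (y : ZLat d) : eucNorm y ^ 2 = ∑ i, (y i : ℝ) ^ 2 := by
  simp [eucNorm, toEuc, EuclideanSpace.norm_sq_eq]

lemma nbrAverage_eucNorm_sq [NeZero d] (y : ZLat d) :
    nbrAverage (fun y => eucNorm y ^ 2) y = eucNorm y ^ 2 + 1 := by
  have hd := cast_dim_pos (d := d)
  have key : ∀ (j : Fin d) (b : Bool), eucNorm (y + unitVec (j, b)) ^ 2 =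
      eucNorm y ^ 2 + (2 * (if b then 1 else -1) * y j + 1) := by
    intro j b
    rw [eucNorm_sq, eucNorm_sq, ← Finset.sum_erase_add _ _ (Finset.mem_univ j),
      ← Finset.sum_erase_add (a := j) _ _ (Finset.mem_univ j)]
    have : ∀ i ∈ Finset.univ.erase j, (((y + unitVec (j, b)) i : ℤ) : ℝ) ^ 2 = (y i : ℝ) ^ 2 := by
      intro i hi
      simp [unitVec, Finset.ne_of_mem_erase hi]
    rw [Finset.sum_congr rfl this]
    cases b <;> simp [unitVec] <;> ring
  simp only [nbrAverage, Fintype.sum_prod_type, Fintype.sum_bool, key]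
  simp only [if_true, Bool.false_eq_true, if_false]
  have : ∀ j : Fin d, (eucNorm y ^ 2 + (2 * 1 * (y j : ℝ) + 1) +
      (eucNorm y ^ 2 + (2 * -1 * (y j : ℝ) + 1))) = 2 * (eucNorm y ^ 2 + 1) := fun j => by ring
  simp only [this, Finset.sum_const, Finset.card_univ, Fintype.card_fin, nsmul_eq_mul]
  field_simp

/-- A function with values in `[0,1]` that is harmonic in the ball of radius `ρ` is at most its
average under the law of the walk at time `t`, up to the probability `t / ρ²` of leaving the ball
by time `t`. -/
lemma le_iterate_nbrAverage_add [NeZero d] {φ : ZLat d → ℝ} (hφ : ∀ y, 0 ≤ φ y ∧ φ y ≤ 1)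
    {ρ : ℝ} (hρ : 0 < ρ) (harm : ∀ y, eucNorm y < ρ → nbrAverage φ y = φ y) (t : ℕ) :
    φ 0 ≤ nbrAverage^[t] φ 0 + t / ρ ^ 2 := by
  -- the Kolmogorov bound holds at every starting point with the Lyapunov function `|y|² + t`
  have hit : ∀ t y, 0 ≤ nbrAverage^[t] φ y := by
    intro t
    induction t with
    | zero => exact fun y => (hφ y).1
    | succ t ih =>
      intro y
      rw [Function.iterate_succ_apply']
      exact le_nbrAverage_of_forall fun s => ih _
  have key : ∀ t y, φ y ≤ nbrAverage^[t] φ y + (ρ ^ 2)⁻¹ * (eucNorm y ^ 2 + t) := by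
    intro t
    induction t with
    | zero =>
      intro y
      simp only [Function.iterate_zero, id_eq, Nat.cast_zero, add_zero]
      have : 0 ≤ (ρ ^ 2)⁻¹ * eucNorm y ^ 2 := by positivity
      linarith
    | succ t ih =>
      intro y
      by_cases hy : eucNorm y < ρ
      · rw [← harm y hy]
        refine (nbrAverage_mono (h := fun y => nbrAverage^[t] φ y +
          (ρ ^ 2)⁻¹ * (eucNorm y ^ 2 + t)) fun s => ih (y + unitVec s)).trans (le_of_eq ?_)
        have e : (fun y => nbrAverage^[t] φ y + (ρ ^ 2)⁻¹ * (eucNorm y ^ 2 + t)) =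
            nbrAverage^[t] φ + ((fun y => (ρ ^ 2)⁻¹ * eucNorm y ^ 2) + fun _ => (ρ ^ 2)⁻¹ * t) := by
          funext y; simp only [Pi.add_apply]; ring
        rw [e, nbrAverage_add, nbrAverage_add, nbrAverage_const, Pi.add_apply, Pi.add_apply,
          nbrAverage_const_mul, nbrAverage_eucNorm_sq, Function.iterate_succ_apply']
        push_cast
        ring
      · have h1 : ρ ^ 2 ≤ eucNorm y ^ 2 := by gcongr; exact not_lt.1 hy
        have h2 : 1 ≤ (ρ ^ 2)⁻¹ * (eucNorm y ^ 2 + (t + 1 : ℕ)) := by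
          rw [← div_eq_inv_mul, le_div_iff₀ (by positivity)]
          push_cast
          linarith [t.cast_nonneg (α := ℝ)]
        linarith [hit (t + 1) y, (hφ y).2]
  have := key t 0
  have e0 : eucNorm (0 : ZLat d) = 0 := by
    have : eucNorm (0 : ZLat d) ^ 2 = 0 := by rw [eucNorm_sq]; simp
    simpa using this
  rw [e0] at this
  calc _ ≤ _ := this
    _ = _ := by ring

/-- Pointwise bound on the equilibrium potential `φ` of a finite set `K`, for conductances bounded
between `c²` and `C²` and constant near `w`: the energy of `φ` is at most of order `|K|`, and
harmonicity of `φ` near `w` turns an energy bound into a pointwise one. -/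
theorem potential_le [NeZero d] (hd : 3 ≤ d) {f φ : ZLat d → ℝ} {K : Set (ZLat d)}
    (hK : K.Finite) {c C : ℝ} (hc : 0 < c) (hf : ∀ y, c ≤ f y ∧ f y ≤ C)
    (hφ : ∀ y, 0 ≤ φ y ∧ φ y ≤ 1) (hlim : Filter.Tendsto φ Filter.cofinite (nhds 0))
    (harm : ∀ y ∉ K, ∑ s : Fin d × Bool, f y * f (y + unitVec s) * (φ y - φ (y + unitVec s)) = 0)
    {w : ZLat d} {ρ : ℝ} (hρ : 0 < ρ)
    (hw : ∀ y, eucNorm (y - w) < ρ → nbrAverage φ y = φ y)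
    {B : ℝ} {t : ℕ} (hB : ∀ N, ∑ n ∈ Finset.range N, heatKernel d (t + t + n) 0 ≤ B)
    {l : ℝ} (hl : 0 < l) :
    φ w ≤ t / ρ ^ 2 + (1 / 2) * (l * B + l⁻¹ * (C ^ 2 / c ^ 2 * K.ncard)) := by
  -- truncate at a small level `η`, so that the energy argument concerns finite sums
  refine le_of_forall_pos_le_add fun η hη => ?_
  set φ' : ZLat d → ℝ := fun y => φ (w + y) with hφ'
  set f' : ZLat d → ℝ := fun y => f (w + y) with hf'
  set K' : Set (ZLat d) := (fun y => w + y) ⁻¹' K with hK'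
  have hK'fin : K'.Finite := hK.preimage (add_right_injective w).injOn
  have hcard : K'.ncard = K.ncard :=
    Set.ncard_preimage_of_injective_subset_range (add_right_injective w)
      fun y _ => ⟨y - w, by simp⟩
  set ψ : ZLat d → ℝ := fun y => max (φ' y - η) 0 with hψ
  have hfin : ψ.support.Finite := by
    have h1 : {y | ¬ φ y < η}.Finite := Filter.eventually_cofinite.1 (hlim.eventually_lt_const hη)
    refine (h1.preimage (add_right_injective w).injOn).subset fun y hy => ?_
    simp only [mem_preimage, mem_ofPred_eq]
    intro hlt
    exact hy (max_eq_right (by simp only [hφ']; linarith))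
  have hen := energy_truncation_le (f := f') (φ := φ') hK'fin hc (fun y => hf _) (fun y => hφ _)
    (fun y hy => by
      have := harm (w + y) hy
      simpa only [hφ', hf', add_assoc] using this) hη.le (fun _ => rfl) hfin
  have hheat := tsum_heatKernel_mul_le_energy hd hfin hB hl
  have hsub := le_iterate_nbrAverage_add (φ := φ') (fun y => hφ _) hρ (fun y hy => by
    have h1 := hw (w + y) (by simpa using hy)
    rw [hφ', nbrAverage_translate]; exact h1) t
  rw [← tsum_heatKernel_mul] at hsub
  have hone : ∑' y, heatKernel d t y = 1 := by
    have h1 := tsum_heatKernel_mul (d := d) t (fun _ => 1)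
    have h2 : nbrAverage^[t] (fun _ : ZLat d => (1 : ℝ)) = fun _ => 1 :=
      Function.iterate_fixed (nbrAverage_const 1) t
    rw [h2] at h1
    simpa using h1
  have hle : ∑' y, heatKernel d t y * φ' y ≤ ∑' y, heatKernel d t y * ψ y + η := by
    have sφ : ∀ g : ZLat d → ℝ, Summable fun y => heatKernel d t y * g y := fun g =>
      summable_of_support_subset (heatKernel_finite_support (d := d) t)
        fun y hy => by rw [hy, zero_mul]
    calc _ ≤ ∑' y, (heatKernel d t y * ψ y + heatKernel d t y * η) := by
          refine Summable.tsum_le_tsum (fun y => ?_) (sφ _) ((sφ _).add (sφ _))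
          rw [← mul_add]
          refine mul_le_mul_of_nonneg_left ?_ (heatKernel_nonneg t y)
          have := le_max_left (φ' y - η) 0
          simp only [hψ]
          linarith
      _ = _ := by rw [(sφ _).tsum_add (sφ _), tsum_mul_right, hone, one_mul]
  have hmono : l⁻¹ * ∑' y, ψ y * (ψ y - nbrAverage ψ y) ≤ l⁻¹ * (C ^ 2 / c ^ 2 * K.ncard) := by
    rw [hcard] at hen
    gcongr
  have e0 : φ' 0 = φ w := by simp [hφ']
  rw [← e0]
  linarith

end energy

/-! ### The one-step decomposition of the walk -/

section step
variable {d : ℕ}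

/-- The sample with first jump and holding time `a`, followed by `ω`. -/
def consSample (a : (Fin d × Bool) × ℝ) (ω : Sample d) : Sample d
  | 0 => a
  | n + 1 => ω n

lemma measurable_consSample :
    Measurable fun p : ((Fin d × Bool) × ℝ) × Sample d => consSample p.1 p.2 := by
  refine measurable_pi_lambda _ fun n => ?_
  cases n with
  | zero => exact measurable_fst
  | succ n => exact (measurable_pi_apply n).comp measurable_snd

lemma skeleton_zero (x : ZLat d) (ω : Sample d) : skeleton x ω 0 = x := by simp [skeleton]

lemma skeleton_cons (x : ZLat d) (a : (Fin d × Bool) × ℝ) (ω : Sample d) (n : ℕ) :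
    skeleton x (consSample a ω) (n + 1) = skeleton (x + unitVec a.1) ω n := by
  simp only [skeleton, Finset.sum_range_succ', consSample]
  abel

lemma jumpTime_cons (a : (Fin d × Bool) × ℝ) (ω : Sample d) (n : ℕ) :
    jumpTime (consSample a ω) (n + 1) = a.2 + jumpTime ω n := by
  simp only [jumpTime, Finset.sum_range_succ', consSample]
  ring

lemma measurable_skeleton (x : ZLat d) (n : ℕ) : Measurable fun ω => skeleton x ω n := by
  unfold skeleton
  refine measurable_const.add (Finset.measurable_sum _ fun i _ => ?_)
  exact (measurable_of_countable (unitVec (d := d))).comp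
    (measurable_fst.comp (measurable_pi_apply i))

lemma measurable_jumpTime (n : ℕ) : Measurable fun ω : Sample d => jumpTime ω n := by
  unfold jumpTime
  exact Finset.measurable_sum _ fun i _ => measurable_snd.comp (measurable_pi_apply i)

variable [NeZero d]

instance : IsProbabilityMeasure (sampleMeasure d) := by unfold sampleMeasure; infer_instance

/-- Removing the first jump leaves the law of the remaining sample unchanged. -/
lemma map_consSample : Measure.map (fun p : ((Fin d × Bool) × ℝ) × Sample d => consSample p.1 p.2)
    (((dirMeasure d).prod holdMeasure).prod (sampleMeasure d)) = sampleMeasure d := by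
  refine Measure.eq_infinitePi _ fun s t ht => ?_
  classical
  obtain ⟨N, hN⟩ : ∃ N, s ⊆ Finset.range (N + 1) :=
    ⟨s.sup id, fun i hi => Finset.mem_range.2 (Nat.lt_succ_of_le (Finset.le_sup (f := id) hi))⟩
  set t' : ℕ → Set ((Fin d × Bool) × ℝ) := fun n => if n ∈ s then t n else univ with ht'
  have hmt' : ∀ n, MeasurableSet (t' n) := by
    intro n; simp only [ht']; split_ifs; exacts [ht n, MeasurableSet.univ]
  have hset : Set.pi s t = Set.pi (Finset.range (N + 1)) t' := by
    ext ω
    simp only [mem_pi, Finset.mem_coe, ht']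
    constructor
    · intro h n _
      split_ifs with hn
      exacts [h n hn, mem_univ _]
    · intro h n hn
      have := h n (hN hn)
      rwa [if_pos hn] at this
  have hpre : (fun p : ((Fin d × Bool) × ℝ) × Sample d => consSample p.1 p.2) ⁻¹'
      (Set.pi (Finset.range (N + 1)) t') =
      t' 0 ×ˢ Set.pi (Finset.range N) fun n => t' (n + 1) := by
    ext ⟨a, ω⟩
    simp only [mem_preimage, mem_pi, Finset.mem_coe, Finset.mem_range, mem_prod]
    constructor
    · intro h
      exact ⟨h 0 (Nat.succ_pos N), fun n hn => h (n + 1) (Nat.succ_lt_succ hn)⟩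
    · rintro ⟨h0, h1⟩ n hn
      cases n with
      | zero => exact h0
      | succ n => exact h1 n (Nat.lt_of_succ_lt_succ hn)
  have hprod : ∏ i ∈ s, ((dirMeasure d).prod holdMeasure) (t i) =
      ∏ i ∈ Finset.range (N + 1), ((dirMeasure d).prod holdMeasure) (t' i) := by
    rw [← Finset.prod_subset hN fun i _ hi => by simp [ht', hi]]
    exact Finset.prod_congr rfl fun i hi => by simp [ht', hi]
  rw [hprod, hset, Measure.map_apply measurable_consSample
    (MeasurableSet.pi (Finset.countable_toSet _) fun n _ => hmt' n), hpre, Measure.prod_prod,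
    sampleMeasure, Measure.infinitePi_pi _ fun n _ => hmt' _, Finset.prod_range_succ', mul_comm]

/-- `ℝ≥0∞`-valued version of `nbrAverage`. -/
noncomputable def lavg (g : ZLat d → ℝ≥0∞) (y : ZLat d) : ℝ≥0∞ :=
  (2 * (d : ℝ≥0∞))⁻¹ * ∑ s : Fin d × Bool, g (y + unitVec s)

lemma lavg_ofReal {g : ZLat d → ℝ} {y : ZLat d} (hg : ∀ s, 0 ≤ g (y + unitVec s)) :
    lavg (fun w => ENNReal.ofReal (g w)) y = ENNReal.ofReal (nbrAverage g y) := by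
  have hd := cast_dim_pos (d := d)
  rw [lavg, nbrAverage, ENNReal.ofReal_mul (by positivity), ENNReal.ofReal_sum_of_nonneg
    fun s _ => hg s, one_div, ENNReal.ofReal_inv_of_pos (by positivity),
    ENNReal.ofReal_mul (by norm_num)]
  simp

lemma lintegral_dirMeasure (g : Fin d × Bool → ℝ≥0∞) :
    ∫⁻ s, g s ∂dirMeasure d = (2 * (d : ℝ≥0∞))⁻¹ * ∑ s, g s := by
  rw [lintegral_fintype, Finset.mul_sum]
  refine Finset.sum_congr rfl fun s _ => ?_
  rw [dirMeasure, PMF.toMeasure_apply_singleton _ _ (measurableSet_singleton s),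
    PMF.uniformOfFintype_apply, mul_comm]
  congr 2
  simp
  exact mul_comm _ _

/-- First-step analysis: if after the first step `F` factors into a function of the first holding
time and a function of the path from the first jump on, so does its expectation. -/
lemma lintegral_first_step {F : Sample d → ℝ≥0∞} (hF : Measurable F) {A : ℝ → ℝ≥0∞}
    (hA : Measurable A) {H : ZLat d → Sample d → ℝ≥0∞} (hH : ∀ y, Measurable (H y)) (y : ZLat d)
    (h : ∀ a ω, F (consSample a ω) = A a.2 * H (y + unitVec a.1) ω) :
    ∫⁻ ω, F ω ∂sampleMeasure d =
      (∫⁻ τ, A τ ∂holdMeasure) * lavg (fun w => ∫⁻ ω, H w ω ∂sampleMeasure d) y := by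
  conv_lhs => rw [← map_consSample]
  rw [lintegral_map hF measurable_consSample, lintegral_prod
    (fun p : ((Fin d × Bool) × ℝ) × Sample d => F (consSample p.1 p.2))
    (hF.comp measurable_consSample).aemeasurable]
  have hm : Measurable fun s : Fin d × Bool => ∫⁻ ω, H (y + unitVec s) ω ∂sampleMeasure d :=
    measurable_of_countable _
  calc _ = ∫⁻ a : (Fin d × Bool) × ℝ, (∫⁻ ω, H (y + unitVec a.1) ω ∂sampleMeasure d) * A a.2
        ∂((dirMeasure d).prod holdMeasure) := by
        refine lintegral_congr fun a => ?_
        rw [mul_comm, ← lintegral_const_mul (A a.2) (hH (y + unitVec a.1))]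
        exact lintegral_congr fun ω => h a ω
    _ = _ := by
      rw [lintegral_prod_mul hm.aemeasurable hA.aemeasurable, lintegral_dirMeasure, lavg, mul_comm]

end step

/-! ### Exponential holding times and almost sure properties of the paths -/

section paths

/-- The exponential moment `E[e^{vτ}] = 1/(1-v)` of a holding time. -/
lemma lintegral_exp_holdMeasure {v : ℝ} (hv : v < 1) :
    ∫⁻ τ, ENNReal.ofReal (Real.exp (v * τ)) ∂holdMeasure = ENNReal.ofReal (1 / (1 - v)) := by
  have h0 : 0 < 1 - v := by linarith
  have : holdMeasure = volume.withDensity (ProbabilityTheory.exponentialPDF 1) := rfl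
  have hm : ∀ r, Measurable (ProbabilityTheory.exponentialPDF r) := fun r =>
    (ProbabilityTheory.measurable_exponentialPDFReal r).ennreal_ofReal
  rw [this, lintegral_withDensity_eq_lintegral_mul _ (hm 1) (by fun_prop)]
  have e : (ProbabilityTheory.exponentialPDF 1 * fun τ => ENNReal.ofReal (Real.exp (v * τ))) =
      fun τ => ENNReal.ofReal (1 / (1 - v)) * ProbabilityTheory.exponentialPDF (1 - v) τ := by
    funext τ
    simp only [Pi.mul_apply, ProbabilityTheory.exponentialPDF_eq]
    split_ifs with h
    · rw [← ENNReal.ofReal_mul (by positivity), ← ENNReal.ofReal_mul (by positivity), one_mul,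
        ← Real.exp_add, ← mul_assoc, one_div_mul_cancel h0.ne', one_mul]
      congr 2
      ring_nf
    · simp
  rw [e, lintegral_const_mul _ (hm _), ProbabilityTheory.lintegral_exponentialPDF_eq_one h0, mul_one]

lemma ae_holdMeasure_pos : ∀ᵐ τ ∂holdMeasure, 0 < τ := by
  have : holdMeasure = volume.withDensity (ProbabilityTheory.exponentialPDF 1) := rfl
  have hm : Measurable (ProbabilityTheory.exponentialPDF 1) :=
    (ProbabilityTheory.measurable_exponentialPDFReal 1).ennreal_ofReal
  rw [this, ae_withDensity_iff hm]
  filter_upwards [Measure.ae_ne volume (0 : ℝ)] with τ h0 h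
  by_contra hc
  exact h (ProbabilityTheory.exponentialPDF_of_neg (lt_of_le_of_ne (not_lt.1 hc) h0))

variable {d : ℕ}

/-- The regular samples: holding times are positive and the walk makes finitely many jumps in
bounded time. -/
def IsRegular (ω : Sample d) : Prop :=
  (∀ n, 0 < (ω n).2) ∧ ∀ t : ℝ, ∃ n, t < jumpTime ω n

lemma lintegral_exp_neg_jumpTime [NeZero d] (n : ℕ) :
    ∫⁻ ω, ENNReal.ofReal (Real.exp (-jumpTime ω n)) ∂sampleMeasure d = ENNReal.ofReal (1 / 2) ^ n := by
  have hm : ∀ n, Measurable fun ω : Sample d => ENNReal.ofReal (Real.exp (-jumpTime ω n)) :=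
    fun n => ((measurable_jumpTime n).neg.exp).ennreal_ofReal
  induction n with
  | zero => simp [jumpTime]
  | succ n ih =>
    rw [lintegral_first_step (hm (n + 1)) (A := fun τ => ENNReal.ofReal (Real.exp (-1 * τ)))
      (by fun_prop) (H := fun _ ω => ENNReal.ofReal (Real.exp (-jumpTime ω n))) (fun _ => hm n) 0,
      lintegral_exp_holdMeasure (by norm_num)]
    · simp only [ih]
      have : lavg (fun _ : ZLat d => ENNReal.ofReal (1 / 2) ^ n) 0 = ENNReal.ofReal (1 / 2) ^ n := by
        have := lavg_ofReal (d := d) (g := fun _ => (1 / 2 : ℝ) ^ n) (y := 0)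
          fun _ => by positivity
        rw [nbrAverage_const] at this
        simpa only [ENNReal.ofReal_pow (show (0 : ℝ) ≤ 1 / 2 by norm_num)] using this
      rw [this, pow_succ, mul_comm]
      norm_num
    · intro a ω
      rw [jumpTime_cons, ← ENNReal.ofReal_mul (by positivity), ← Real.exp_add]
      congr 2
      ring

lemma ae_isRegular [NeZero d] : ∀ᵐ ω ∂sampleMeasure d, IsRegular ω := by
  have h1 : ∀ᵐ ω ∂sampleMeasure d, ∀ n, 0 < (ω n).2 := by
    refine ae_all_iff.2 fun n => ?_
    have h := measurePreserving_eval_infinitePi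
      (fun _ : ℕ => (dirMeasure d).prod holdMeasure) n
    exact h.quasiMeasurePreserving.ae (Measure.quasiMeasurePreserving_snd.ae ae_holdMeasure_pos)
  have h2 : ∀ M : ℕ, ∀ᵐ ω ∂sampleMeasure d, ∃ n, (M : ℝ) < jumpTime ω n := by
    intro M
    rw [ae_iff]
    have hle : ∀ n, sampleMeasure d {ω | ¬∃ n, (M : ℝ) < jumpTime ω n} ≤
        ENNReal.ofReal (Real.exp M) * ENNReal.ofReal (1 / 2) ^ n := by
      intro n
      rw [← lintegral_exp_neg_jumpTime (d := d), ← lintegral_const_mul' _ _ ENNReal.ofReal_ne_top]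
      set S := {ω : Sample d | 1 ≤ ENNReal.ofReal (Real.exp M) *
        ENNReal.ofReal (Real.exp (-jumpTime ω n))}
      calc sampleMeasure d {ω | ¬∃ n, (M : ℝ) < jumpTime ω n} ≤ sampleMeasure d S := by
            refine measure_mono fun ω hω => ?_
            have : jumpTime ω n ≤ M := not_lt.1 fun h => hω ⟨n, h⟩
            simp only [S, mem_ofPred_eq]
            rw [← ENNReal.ofReal_mul (by positivity), ← Real.exp_add, ENNReal.one_le_ofReal]
            exact Real.one_le_exp (by linarith)
        _ ≤ _ := by
            have := mul_meas_ge_le_lintegral₀ (μ := sampleMeasure d) (f := fun ω =>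
              ENNReal.ofReal (Real.exp M) * ENNReal.ofReal (Real.exp (-jumpTime ω n)))
              (((measurable_jumpTime n).neg.exp).ennreal_ofReal.const_mul _).aemeasurable 1
            simpa using this
    have hlim : Filter.Tendsto (fun n : ℕ => ENNReal.ofReal (Real.exp M) *
        ENNReal.ofReal (1 / 2) ^ n) Filter.atTop (nhds 0) := by
      rw [← mul_zero (ENNReal.ofReal (Real.exp M))]
      refine ENNReal.Tendsto.const_mul (ENNReal.tendsto_pow_atTop_nhds_zero_of_lt_one ?_)
        (Or.inr ENNReal.ofReal_ne_top)
      rw [ENNReal.ofReal_lt_one]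
      norm_num
    exact le_antisymm (ge_of_tendsto' hlim hle) bot_le
  filter_upwards [h1, ae_all_iff.2 h2] with ω hω1 hω2
  refine ⟨hω1, fun t => ?_⟩
  obtain ⟨M, hM⟩ := exists_nat_ge t
  obtain ⟨n, hn⟩ := hω2 M
  exact ⟨n, hM.trans_lt hn⟩

lemma IsRegular.strictMono {ω : Sample d} (h : IsRegular ω) : StrictMono (jumpTime ω) :=
  strictMono_nat_of_lt_succ fun n => by
    simp only [jumpTime, Finset.sum_range_succ]
    linarith [h.1 n]

lemma jumpTime_zero (ω : Sample d) : jumpTime ω 0 = 0 := by simp [jumpTime]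

lemma IsRegular.walk_eq {ω : Sample d} (h : IsRegular ω) (x : ZLat d) {n : ℕ} {t : ℝ}
    (h1 : jumpTime ω n ≤ t) (h2 : t < jumpTime ω (n + 1)) : walk x ω t = skeleton x ω n := by
  have : {m : ℕ | jumpTime ω m ≤ t} = Iic n := by
    ext m
    simp only [mem_ofPred_eq, mem_Iic]
    constructor
    · intro hm
      by_contra hc
      have := h.strictMono.monotone (Nat.succ_le_of_lt (not_le.1 hc))
      exact absurd (h2.trans_le (this.trans hm)) (lt_irrefl _)
    · exact fun hm => (h.strictMono.monotone hm).trans h1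
  rw [walk, this, csSup_Iic]

lemma IsRegular.exists_jumpTime {ω : Sample d} (h : IsRegular ω) {t : ℝ} (ht : 0 ≤ t) :
    ∃ n, jumpTime ω n ≤ t ∧ t < jumpTime ω (n + 1) := by
  classical
  have hex := h.2 t
  have hpos : Nat.find hex ≠ 0 := by
    intro h0
    have := Nat.find_spec hex
    rw [h0, jumpTime_zero] at this
    linarith
  obtain ⟨n, hn⟩ := Nat.exists_eq_succ_of_ne_zero hpos
  refine ⟨n, not_lt.1 (Nat.find_min hex (by omega)), ?_⟩
  have := Nat.find_spec hex
  rwa [hn] at this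

lemma IsRegular.jumpTime_nonneg {ω : Sample d} (h : IsRegular ω) (n : ℕ) : 0 ≤ jumpTime ω n := by
  have := h.strictMono.monotone (Nat.zero_le n)
  rwa [jumpTime_zero] at this

lemma IsRegular.walk_jumpTime {ω : Sample d} (h : IsRegular ω) (x : ZLat d) (n : ℕ) :
    walk x ω (jumpTime ω n) = skeleton x ω n :=
  h.walk_eq x le_rfl (h.strictMono n.lt_succ_self)

lemma IsRegular.walk_zero {ω : Sample d} (h : IsRegular ω) (x : ZLat d) : walk x ω 0 = x := by
  have := h.walk_jumpTime x 0
  rwa [jumpTime_zero, skeleton_zero] at this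

lemma unitVec_ne_zero (s : Fin d × Bool) : unitVec s ≠ 0 := by
  intro h
  have := congrFun h s.1
  rcases s with ⟨i, b⟩
  cases b <;> simp [unitVec] at this

lemma IsRegular.returnTime_eq_top_iff {ω : Sample d} (h : IsRegular ω) (K : Set (ZLat d))
    (x : ZLat d) : returnTime K x ω = ⊤ ↔ ∀ n, skeleton x ω (n + 1) ∉ K := by
  simp only [returnTime, iInf_eq_top, ENNReal.coe_ne_top, imp_false]
  constructor
  · intro H n hn
    refine H (NNReal.mk (jumpTime ω (n + 1)) (h.jumpTime_nonneg _)) ⟨?_,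
      NNReal.mk (jumpTime ω 1) (h.jumpTime_nonneg _), ?_, ?_⟩
    · rwa [NNReal.coe_mk, h.walk_jumpTime]
    · exact h.strictMono.monotone (by omega)
    · rw [NNReal.coe_mk, h.walk_jumpTime, h.walk_zero]
      simp [skeleton, unitVec_ne_zero]
  · rintro H t ⟨ht, s, hst, hs⟩
    obtain ⟨n, h1, h2⟩ := h.exists_jumpTime t.2
    cases n with
    | zero =>
      apply hs
      rw [h.walk_zero, h.walk_eq x (n := 0), skeleton_zero]
      · rw [jumpTime_zero]; exact s.2
      · exact lt_of_le_of_lt hst h2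
    | succ n =>
      have e : walk x ω (t : ℝ) = skeleton x ω (n + 1) := h.walk_eq x h1 h2
      rw [e] at ht
      exact H n ht

/-- If the path eventually avoids the support of `V`, then `∫₀^∞ V(X_s) ds` is the sum of the
values of `V` along the path, weighted by the holding times. -/
lemma IsRegular.integral_walk {ω : Sample d} (h : IsRegular ω) (V : ZLat d → ℝ) (x : ZLat d)
    {N : ℕ} (hN : ∀ n, N ≤ n → V (skeleton x ω n) = 0) :
    ∫ s in Ioi (0 : ℝ), V (walk x ω s) =
      ∑ n ∈ Finset.range N, V (skeleton x ω n) * (ω n).2 := by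
  rw [← integral_Ici_eq_integral_Ioi]
  have e : ∀ s ∈ Ici (0 : ℝ), V (walk x ω s) = ∑ n ∈ Finset.range N,
      (Ico (jumpTime ω n) (jumpTime ω (n + 1))).indicator (fun _ => V (skeleton x ω n)) s := by
    intro s hs
    obtain ⟨m, h1, h2⟩ := h.exists_jumpTime hs
    have hz : ∀ n, n ≠ m → (Ico (jumpTime ω n) (jumpTime ω (n + 1))).indicator
        (fun _ => V (skeleton x ω n)) s = 0 := by
      intro n hn
      refine indicator_of_notMem (fun hc => hn ?_) _
      have e1 := h.strictMono.lt_iff_lt.1 (hc.1.trans_lt h2)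
      have e2 := h.strictMono.lt_iff_lt.1 (h1.trans_lt hc.2)
      omega
    rw [h.walk_eq x h1 h2]
    by_cases hm : m < N
    · rw [Finset.sum_eq_single m (fun n _ hn => hz n hn)
        (fun hc => absurd (Finset.mem_range.2 hm) hc), indicator_of_mem (by exact ⟨h1, h2⟩)]
    · rw [hN m (not_lt.1 hm)]
      refine (Finset.sum_eq_zero fun n hn => hz n ?_).symm
      have := Finset.mem_range.1 hn
      omega
  rw [setIntegral_congr_fun measurableSet_Ici e, integral_finsetSum]
  · refine Finset.sum_congr rfl fun n _ => ?_
    have hsub : Ici (0 : ℝ) ∩ Ico (jumpTime ω n) (jumpTime ω (n + 1)) =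
        Ico (jumpTime ω n) (jumpTime ω (n + 1)) :=
      inter_eq_right.2 fun s hs => (h.jumpTime_nonneg n).trans hs.1
    rw [setIntegral_indicator measurableSet_Ico, hsub, setIntegral_const, smul_eq_mul,
      Real.volume_real_Ico_of_le (h.strictMono n.lt_succ_self).le, mul_comm]
    simp only [jumpTime, Finset.sum_range_succ]
    ring
  · intro n _
    refine (IntegrableOn.integrable_indicator ?_ measurableSet_Ico).integrableOn
    exact integrableOn_const (by simp)

end paths

/-! ### Entrance and exit times -/

section entrance
variable {d : ℕ} [NeZero d]

lemma hitBeforeExit_mem_Icc (A B : Set (ZLat d)) (y : ZLat d) : hitBeforeExit A B y ∈ Icc (0 : ℝ) 1 :=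
  ⟨measureReal_nonneg, measureReal_le_one⟩

lemma hitBeforeExit_eq_one {A B : Set (ZLat d)} {y : ZLat d} (hA : y ∈ A) (hB : y ∈ B) :
    hitBeforeExit A B y = 1 := by
  have : ∀ᵐ ω ∂sampleMeasure d, entranceTime A y ω < exitTime B y ω := by
    filter_upwards [ae_isRegular (d := d)] with ω h
    have h0 : entranceTime A y ω = 0 := by
      refine le_antisymm ?_ bot_le
      have := iInf₂_le (f := fun (t : ℝ≥0) (_ : walk y ω t ∈ A) => (t : ℝ≥0∞)) 0
        (by rwa [NNReal.coe_zero, h.walk_zero])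
      simpa [entranceTime] using this
    have h1 : (NNReal.mk (jumpTime ω 1) (h.jumpTime_nonneg 1) : ℝ≥0∞) ≤ exitTime B y ω := by
      refine le_iInf₂ fun t ht => ?_
      refine ENNReal.coe_le_coe.2 (not_lt.1 fun hlt => ht ?_)
      have hw : walk y ω (t : ℝ) = skeleton y ω 0 :=
        h.walk_eq y (by rw [jumpTime_zero]; exact t.2) hlt
      rwa [hw, skeleton_zero]
    rw [h0]
    refine lt_of_lt_of_le ?_ h1
    have := h.strictMono Nat.zero_lt_one
    rw [jumpTime_zero] at this
    exact ENNReal.coe_pos.2 (NNReal.coe_pos.1 this)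
  rw [hitBeforeExit, measureReal_def, (prob_compl_eq_zero_iff₀ ?_).1 this, ENNReal.toReal_one]
  exact (NullMeasurableSet.of_compl (NullMeasurableSet.of_null this))

lemma hitBeforeExit_eq_zero {A B : Set (ZLat d)} {y : ZLat d} (hB : y ∉ B) :
    hitBeforeExit A B y = 0 := by
  have : ∀ᵐ ω ∂sampleMeasure d, ¬ entranceTime A y ω < exitTime B y ω := by
    filter_upwards [ae_isRegular (d := d)] with ω h
    have h0 : exitTime B y ω = 0 := by
      refine le_antisymm ?_ bot_le
      have := iInf₂_le (f := fun (t : ℝ≥0) (_ : walk y ω t ∈ Bᶜ) => (t : ℝ≥0∞)) 0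
        (by rwa [NNReal.coe_zero, h.walk_zero])
      simpa [exitTime, entranceTime] using this
    rw [h0]
    exact not_lt_bot
  rw [ae_iff] at this
  simp only [not_not] at this
  rw [hitBeforeExit, measureReal_def, this, ENNReal.toReal_zero]

end entrance

/-! ### Transience -/

section transience
variable {d : ℕ} [NeZero d]

lemma sampleMeasure_skeleton_eq (n : ℕ) (y w : ZLat d) :
    sampleMeasure d {ω | skeleton y ω n = w} = ENNReal.ofReal (heatKernel d n (y - w)) := by
  have hm : ∀ n (y : ZLat d), MeasurableSet {ω : Sample d | skeleton y ω n = w} := fun n y =>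
    measurable_skeleton y n (measurableSet_singleton w)
  induction n generalizing y with
  | zero =>
    by_cases h : y = w
    · simp [skeleton_zero, h, heatKernel]
    · simp [skeleton_zero, h, heatKernel, sub_eq_zero]
  | succ n ih =>
    rw [← lintegral_indicator_one (hm _ _), lintegral_first_step (A := fun _ => 1)
      (H := fun z => {ω | skeleton z ω n = w}.indicator 1)
      (measurable_one.indicator (hm _ _)) measurable_const
      (fun z => measurable_one.indicator (hm _ _)) y]
    · simp only [lintegral_const, measure_univ, mul_one, one_mul, lintegral_indicator_one (hm _ _),
        ih]
      rw [lavg_ofReal (g := fun z => heatKernel d n (z - w)) fun s => heatKernel_nonneg _ _]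
      congr 1
      simp only [heatKernel, nbrAverage, sub_add_eq_add_sub]
    · intro a ω
      simp only [one_mul, indicator, mem_ofPred_eq, skeleton_cons, Pi.one_apply]

/-- A summable bound on the heat kernel, uniform in space. -/
lemma exists_summable_heatKernel_le (hd : 3 ≤ d) :
    ∃ b : ℕ → ℝ, Summable b ∧ ∀ n (y : ZLat d), heatKernel d n y ≤ b n := by
  obtain ⟨A, hA, h⟩ := exists_heatKernel_le d
  have hd' : (3 : ℝ) ≤ d := by exact_mod_cast hd
  have hs : Summable fun n : ℕ => A * (n : ℝ) ^ (-((d : ℝ) / 2)) :=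
    (Real.summable_nat_rpow.2 (by linarith)).mul_left A
  refine ⟨fun n => (if n = 0 then 1 else 0) + A * (n : ℝ) ^ (-((d : ℝ) / 2)),
    (summable_of_hasFiniteSupport ((Set.finite_singleton 0).subset fun n hn => ?_)).add hs,
    fun n y => ?_⟩
  · by_contra hc
    exact hn (if_neg hc)
  · rcases Nat.eq_zero_or_pos n with rfl | hn
    · have : heatKernel d 0 y ≤ 1 := by
        by_cases hy : y = 0
        · simp [heatKernel, hy]
        · simp [heatKernel, hy]
      have h2 : 0 ≤ A * ((0 : ℕ) : ℝ) ^ (-((d : ℝ) / 2)) := by positivity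
      simp only [if_true]
      linarith
    · simpa [hn.ne'] using h n hn y

/-- The Green function of the simple random walk. -/
noncomputable def green (d : ℕ) (y : ZLat d) : ℝ := ∑' n, heatKernel d n y

lemma summable_heatKernel (hd : 3 ≤ d) (y : ZLat d) : Summable fun n => heatKernel d n y := by
  obtain ⟨b, hb, h⟩ := exists_summable_heatKernel_le hd
  exact hb.of_nonneg_of_le (fun n => heatKernel_nonneg n y) fun n => h n y

lemma tendsto_green (hd : 3 ≤ d) : Filter.Tendsto (green d) Filter.cofinite (nhds 0) := by
  obtain ⟨b, hb, h⟩ := exists_summable_heatKernel_le hd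
  have := tendsto_tsum_of_dominated_convergence (𝓕 := (Filter.cofinite : Filter (ZLat d)))
    (f := fun y n => heatKernel d n y) (g := fun _ => 0) hb (fun n => ?_)
    (Filter.Eventually.of_forall fun y n => ?_)
  · have e : green d = fun y => ∑' n, heatKernel d n y := rfl
    rw [e]
    simpa using this
  · refine tendsto_const_nhds.congr' ?_
    have h0 : ∀ᶠ y in Filter.cofinite, y ∉ (heatKernel d n).support :=
      Filter.eventually_cofinite.2 ((heatKernel_finite_support (d := d) n).subset
        fun y hy => not_not.1 hy)
    filter_upwards [h0] with y hy
    exact (not_not.1 hy).symm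
  · rw [Real.norm_of_nonneg (heatKernel_nonneg n y)]
    exact h n y

lemma tsum_sampleMeasure_skeleton (hd : 3 ≤ d) (y w : ZLat d) :
    ∑' n, sampleMeasure d {ω | skeleton y ω n = w} = ENNReal.ofReal (green d (y - w)) := by
  simp only [sampleMeasure_skeleton_eq]
  exact (ENNReal.ofReal_tsum_of_nonneg (fun n => heatKernel_nonneg _ _)
    (summable_heatKernel hd _)).symm

/-- The walk eventually leaves every finite set. -/
lemma ae_eventually_skeleton_notMem (hd : 3 ≤ d) (y : ZLat d) {U : Set (ZLat d)} (hU : U.Finite) :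
    ∀ᵐ ω ∂sampleMeasure d, ∃ N, ∀ n, N ≤ n → skeleton y ω n ∉ U := by
  have h1 : ∀ w ∈ U, ∀ᵐ ω ∂sampleMeasure d, ∀ᶠ n in Filter.atTop, skeleton y ω n ≠ w := by
    intro w _
    refine ae_eventually_notMem (s := fun n => {ω | skeleton y ω n = w}) ?_
    rw [tsum_sampleMeasure_skeleton hd]
    exact ENNReal.ofReal_ne_top
  filter_upwards [(ae_ball_iff hU.countable).2 h1] with ω hω
  have := (Filter.eventually_all_finite hU).2 hω
  obtain ⟨N, hN⟩ := Filter.eventually_atTop.1 this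
  exact ⟨N, fun n hn hc => hN n hn _ hc rfl⟩

end transience

/-! ### Feynman–Kac weights -/

section weights
variable {d : ℕ}

/-- The Feynman–Kac weight `exp(∑_{n<N} V(S_n) τ_n)` of the first `N` steps. -/
noncomputable def pathWeight (V : ZLat d → ℝ) (y : ZLat d) (N : ℕ) (ω : Sample d) : ℝ≥0∞ :=
  ENNReal.ofReal (Real.exp (∑ n ∈ Finset.range N, V (skeleton y ω n) * (ω n).2))

/-- The Feynman–Kac weight of the whole path. For finitely supported `V` the weights of the initial
segments are almost surely eventually constant; the lower limit makes it measurable. -/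
noncomputable def totalWeight (V : ZLat d → ℝ) (y : ZLat d) (ω : Sample d) : ℝ≥0∞ :=
  Filter.liminf (fun N => pathWeight V y N ω) Filter.atTop

lemma measurable_pathWeight (V : ZLat d → ℝ) (y : ZLat d) (N : ℕ) :
    Measurable (pathWeight V y N) := by
  refine (Finset.measurable_sum _ fun n _ => ?_).exp.ennreal_ofReal
  exact ((measurable_of_countable V).comp (measurable_skeleton y n)).mul
    (measurable_snd.comp (measurable_pi_apply n))

lemma measurable_totalWeight (V : ZLat d → ℝ) (y : ZLat d) : Measurable (totalWeight V y) :=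
  Measurable.liminf fun N => measurable_pathWeight V y N

lemma pathWeight_cons (V : ZLat d → ℝ) (y : ZLat d) (N : ℕ) (a : (Fin d × Bool) × ℝ)
    (ω : Sample d) : pathWeight V y (N + 1) (consSample a ω) =
      ENNReal.ofReal (Real.exp (V y * a.2)) * pathWeight V (y + unitVec a.1) N ω := by
  rw [pathWeight, pathWeight, ← ENNReal.ofReal_mul (by positivity), ← Real.exp_add,
    Finset.sum_range_succ']
  simp only [skeleton_cons, skeleton_zero, consSample]
  rw [add_comm]

lemma totalWeight_cons (V : ZLat d → ℝ) (y : ZLat d) (a : (Fin d × Bool) × ℝ) (ω : Sample d) :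
    totalWeight V y (consSample a ω) =
      ENNReal.ofReal (Real.exp (V y * a.2)) * totalWeight V (y + unitVec a.1) ω := by
  rw [totalWeight, totalWeight, ← Filter.liminf_nat_add _ 1]
  simp only [pathWeight_cons]
  exact ENNReal.liminf_const_mul_of_ne_top ENNReal.ofReal_ne_top

lemma totalWeight_eq {V : ZLat d → ℝ} {y : ZLat d} {ω : Sample d} {N : ℕ}
    (hN : ∀ n, N ≤ n → V (skeleton y ω n) = 0) : totalWeight V y ω = pathWeight V y N ω := by
  rw [totalWeight]
  refine (Filter.Tendsto.liminf_eq ?_)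
  refine tendsto_const_nhds.congr' ?_
  filter_upwards [Filter.eventually_ge_atTop N] with M hM
  rw [pathWeight, pathWeight, ← Finset.sum_subset (Finset.range_mono hM)]
  intro n _ hn
  rw [hN n (by simpa using hn), zero_mul]

/-- The samples for which the walk avoids `K` at all times. -/
def avoids (K : Set (ZLat d)) (y : ZLat d) : Set (Sample d) := {ω | ∀ n, skeleton y ω n ∉ K}

/-- The samples for which the walk avoids `K` from the first jump on. -/
def noReturn (K : Set (ZLat d)) (y : ZLat d) : Set (Sample d) :=
  {ω | ∀ n, skeleton y ω (n + 1) ∉ K}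

lemma measurableSet_avoids (K : Set (ZLat d)) (y : ZLat d) : MeasurableSet (avoids K y) := by
  simp only [avoids, ofPred_forall]
  exact MeasurableSet.iInter fun n =>
    measurable_skeleton y n (Set.to_countable Kᶜ).measurableSet

lemma measurableSet_noReturn (K : Set (ZLat d)) (y : ZLat d) : MeasurableSet (noReturn K y) := by
  simp only [noReturn, ofPred_forall]
  exact MeasurableSet.iInter fun n =>
    measurable_skeleton y (n + 1) (Set.to_countable Kᶜ).measurableSet

lemma consSample_mem_noReturn (K : Set (ZLat d)) (y : ZLat d) (a : (Fin d × Bool) × ℝ)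
    (ω : Sample d) : consSample a ω ∈ noReturn K y ↔ ω ∈ avoids K (y + unitVec a.1) := by
  simp only [noReturn, avoids, mem_ofPred_eq, skeleton_cons]

lemma avoids_eq_noReturn {K : Set (ZLat d)} {y : ZLat d} (hy : y ∉ K) :
    avoids K y = noReturn K y := by
  ext ω
  simp only [noReturn, avoids, mem_ofPred_eq]
  refine ⟨fun h n => h _, fun h n => ?_⟩
  cases n with
  | zero => rwa [skeleton_zero]
  | succ n => exact h n

variable [NeZero d]

/-- The gauge function `E_y[exp(∫₀^∞ V(X_s) ds); X avoids K]`, with values in `[0, ∞]`. -/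
noncomputable def lgauge (V : ZLat d → ℝ) (K : Set (ZLat d)) (y : ZLat d) : ℝ≥0∞ :=
  ∫⁻ ω, (avoids K y).indicator (totalWeight V y) ω ∂sampleMeasure d

lemma lintegral_noReturn (V : ZLat d → ℝ) (K : Set (ZLat d)) {y : ZLat d} (hV : V y < 1) :
    ∫⁻ ω, (noReturn K y).indicator (totalWeight V y) ω ∂sampleMeasure d =
      ENNReal.ofReal (1 / (1 - V y)) * lavg (lgauge V K) y := by
  rw [← lintegral_exp_holdMeasure hV]
  refine lintegral_first_step (H := fun z => (avoids K z).indicator (totalWeight V z))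
    ((measurable_totalWeight V y).indicator (measurableSet_noReturn K y)) (by fun_prop)
    (fun z => (measurable_totalWeight V z).indicator (measurableSet_avoids K z)) y ?_
  intro a ω
  by_cases h : ω ∈ avoids K (y + unitVec a.1)
  · rw [indicator_of_mem h, indicator_of_mem ((consSample_mem_noReturn K y a ω).2 h),
      totalWeight_cons]
  · rw [indicator_of_notMem h, indicator_of_notMem (mt (consSample_mem_noReturn K y a ω).1 h),
      mul_zero]

lemma lgauge_eq_of_notMem {V : ZLat d → ℝ} {K : Set (ZLat d)} {y : ZLat d} (hV : V y < 1)
    (hy : y ∉ K) : lgauge V K y = ENNReal.ofReal (1 / (1 - V y)) * lavg (lgauge V K) y := by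
  rw [lgauge, avoids_eq_noReturn hy, lintegral_noReturn V K hV]

lemma lgauge_eq_zero {V : ZLat d → ℝ} {K : Set (ZLat d)} {y : ZLat d} (hy : y ∈ K) :
    lgauge V K y = 0 := by
  have : avoids K y = ∅ := by
    ext ω
    simp only [avoids, mem_ofPred_eq, mem_empty_iff_false, iff_false, not_forall, not_not]
    exact ⟨0, by rwa [skeleton_zero]⟩
  simp [lgauge, this]

/-- Starting far from a finite set, the walk avoids it with probability close to one. -/
lemma one_sub_le_sampleMeasure_avoids (hd : 3 ≤ d) {U : Set (ZLat d)} (hU : U.Finite) (y : ZLat d) :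
    ENNReal.ofReal (1 - ∑ w ∈ hU.toFinset, green d (y - w)) ≤ sampleMeasure d (avoids U y) := by
  have hg : ∀ w, 0 ≤ green d (y - w) := fun w => tsum_nonneg fun n => heatKernel_nonneg _ _
  have h1 : sampleMeasure d (avoids U y)ᶜ ≤
      ENNReal.ofReal (∑ w ∈ hU.toFinset, green d (y - w)) := by
    calc sampleMeasure d (avoids U y)ᶜ
        ≤ sampleMeasure d (⋃ w ∈ hU.toFinset, ⋃ n, {ω | skeleton y ω n = w}) := by
          refine measure_mono fun ω hω => ?_
          simp only [avoids, mem_compl_iff, mem_ofPred_eq, not_forall, not_not] at hω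
          obtain ⟨n, hn⟩ := hω
          simp only [mem_iUnion, mem_ofPred_eq]
          exact ⟨_, by simpa using hn, n, rfl⟩
      _ ≤ ∑ w ∈ hU.toFinset, sampleMeasure d (⋃ n, {ω | skeleton y ω n = w}) :=
          measure_biUnion_finset_le _ _
      _ ≤ ∑ w ∈ hU.toFinset, ENNReal.ofReal (green d (y - w)) := by
          refine Finset.sum_le_sum fun w _ => ?_
          rw [← tsum_sampleMeasure_skeleton hd]
          exact measure_iUnion_le _
      _ = _ := (ENNReal.ofReal_sum_of_nonneg fun w _ => hg w).symm
  rw [← compl_compl (avoids U y), prob_compl_eq_one_sub (measurableSet_avoids U y).compl,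
    ENNReal.ofReal_sub _ (Finset.sum_nonneg fun w _ => hg w), ENNReal.ofReal_one]
  exact tsub_le_tsub_left h1 1

lemma ofReal_le_lgauge (hd : 3 ≤ d) {V : ZLat d → ℝ} {K U : Set (ZLat d)} (hU : U.Finite)
    (hKU : K ⊆ U) (hVU : ∀ y ∉ U, V y = 0) (y : ZLat d) :
    ENNReal.ofReal (1 - ∑ w ∈ hU.toFinset, green d (y - w)) ≤ lgauge V K y := by
  refine (one_sub_le_sampleMeasure_avoids hd hU y).trans ?_
  rw [← lintegral_indicator_one (measurableSet_avoids U y)]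
  refine lintegral_mono fun ω => ?_
  by_cases h : ω ∈ avoids U y
  · have h' : ω ∈ avoids K y := fun n hn => h n (hKU hn)
    rw [indicator_of_mem h, indicator_of_mem h', totalWeight_eq (N := 0) fun n _ => hVU _ (h n)]
    simp [pathWeight]
  · rw [indicator_of_notMem h]
    exact bot_le

end weights

/-! ### The gauge function of the tilted walk -/

section gauge
variable {d : ℕ} [NeZero d]

lemma potential_eq {f : ZLat d → ℝ} {y : ZLat d} (hf : 0 < f y) :
    potential f y = 1 - nbrAverage f y / f y := by
  have hd := cast_dim_pos (d := d)
  have h : ∑ s : Fin d × Bool, (f (y + unitVec s) - f y) = 2 * d * (nbrAverage f y - f y) := by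
    have := sum_sub_unitVec f y
    rw [← neg_inj, ← Finset.sum_neg_distrib]
    simp only [neg_sub]
    rw [this]
    ring
  rw [potential, h]
  field_simp
  ring

lemma nbrAverage_pos {f : ZLat d → ℝ} (hf : ∀ y, 0 < f y) (y : ZLat d) : 0 < nbrAverage f y := by
  have hd := cast_dim_pos (d := d)
  exact mul_pos (by positivity) (Finset.sum_pos (fun s _ => hf _) ⟨(0, true), Finset.mem_univ _⟩)

lemma potential_lt_one {f : ZLat d → ℝ} (hf : ∀ y, 0 < f y) (y : ZLat d) : potential f y < 1 := by
  rw [potential_eq (hf y)]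
  linarith [div_pos (nbrAverage_pos hf y) (hf y)]

lemma one_div_one_sub_potential {f : ZLat d → ℝ} (hf : ∀ y, 0 < f y) (y : ZLat d) :
    1 / (1 - potential f y) = f y / nbrAverage f y := by
  rw [potential_eq (hf y), sub_sub_cancel, one_div_div]

lemma exists_finite_potential_eq_zero {f : ZLat d → ℝ} (hf1 : {y | f y ≠ 1}.Finite) :
    ∃ U : Set (ZLat d), U.Finite ∧ (∀ y ∉ U, f y = 1) ∧ ∀ y ∉ U, potential f y = 0 := by
  set g : ZLat d → ℝ := f - fun _ => 1 with hg
  have hgf : g.support.Finite := hf1.subset fun y hy hc => hy (by simp [hg, hc])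
  refine ⟨g.support ∪ (nbrAverage g).support, hgf.union (finite_support_nbrAverage hgf), ?_, ?_⟩
  · intro y hy
    simp only [mem_union, not_or, Function.mem_support, not_not, hg, Pi.sub_apply] at hy
    linarith [hy.1]
  · intro y hy
    simp only [mem_union, not_or, Function.mem_support, not_not, hg, nbrAverage_sub,
      nbrAverage_const, Pi.sub_apply] at hy
    have h1 : f y = 1 := by linarith [hy.1]
    have h2 : nbrAverage f y = 1 := by linarith [hy.2]
    rw [potential_eq (by rw [h1]; norm_num), h1, h2]
    norm_num

/-- The Feynman–Kac weights turn `f(S_N)` into a martingale. -/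
lemma lintegral_pathWeight_mul {f : ZLat d → ℝ} (hf : ∀ y, 0 < f y) (N : ℕ) (y : ZLat d) :
    ∫⁻ ω, pathWeight (potential f) y N ω * ENNReal.ofReal (f (skeleton y ω N)) ∂sampleMeasure d =
      ENNReal.ofReal (f y) := by
  have hm : ∀ N y, Measurable fun ω : Sample d =>
      pathWeight (potential f) y N ω * ENNReal.ofReal (f (skeleton y ω N)) := fun N y =>
    (measurable_pathWeight _ y N).mul
      ((measurable_of_countable f).comp (measurable_skeleton y N)).ennreal_ofReal
  induction N generalizing y with
  | zero => simp [pathWeight, skeleton_zero]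
  | succ N ih =>
    rw [lintegral_first_step (hm (N + 1) y)
      (A := fun τ => ENNReal.ofReal (Real.exp (potential f y * τ))) (by fun_prop)
      (H := fun z ω => pathWeight (potential f) z N ω * ENNReal.ofReal (f (skeleton z ω N)))
      (hm N) y fun a ω => by rw [pathWeight_cons, skeleton_cons, mul_assoc],
      lintegral_exp_holdMeasure (potential_lt_one hf y), one_div_one_sub_potential hf]
    simp only [ih]
    rw [lavg_ofReal fun s => (hf _).le, ← ENNReal.ofReal_mul
      (div_nonneg (hf y).le (nbrAverage_pos hf y).le), div_mul_cancel₀ _ (nbrAverage_pos hf y).ne']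

lemma lgauge_le (hd : 3 ≤ d) {f : ZLat d → ℝ} (hf : ∀ y, 0 < f y) (hf1 : {y | f y ≠ 1}.Finite)
    (K : Set (ZLat d)) (y : ZLat d) : lgauge (potential f) K y ≤ ENNReal.ofReal (f y) := by
  obtain ⟨U, hU, h1, h0⟩ := exists_finite_potential_eq_zero hf1
  have hm : ∀ N, Measurable fun ω : Sample d =>
      pathWeight (potential f) y N ω * ENNReal.ofReal (f (skeleton y ω N)) := fun N =>
    (measurable_pathWeight _ y N).mul
      ((measurable_of_countable f).comp (measurable_skeleton y N)).ennreal_ofReal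
  calc lgauge (potential f) K y
      ≤ ∫⁻ ω, Filter.liminf (fun N => pathWeight (potential f) y N ω *
          ENNReal.ofReal (f (skeleton y ω N))) Filter.atTop ∂sampleMeasure d := by
        refine lintegral_mono_ae ?_
        filter_upwards [ae_eventually_skeleton_notMem hd y hU] with ω ⟨N, hN⟩
        refine (indicator_le_self _ _ _).trans (le_of_eq ?_)
        refine Filter.liminf_congr ?_
        filter_upwards [Filter.eventually_ge_atTop N] with n hn
        rw [h1 _ (hN n hn), ENNReal.ofReal_one, mul_one]
    _ ≤ Filter.liminf (fun N => ∫⁻ ω, pathWeight (potential f) y N ω *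
          ENNReal.ofReal (f (skeleton y ω N)) ∂sampleMeasure d) Filter.atTop :=
        lintegral_liminf_le hm
    _ = ENNReal.ofReal (f y) := by
        simp only [lintegral_pathWeight_mul hf, Filter.liminf_const]

/-- The real-valued gauge function `E_y[exp(∫₀^∞ V_f(X_s) ds); X avoids K]` of the tilted walk;
divided by `f(y)` it is the probability that the tilted walk started at `y` avoids `K`. -/
noncomputable def gauge (f : ZLat d → ℝ) (K : Set (ZLat d)) (y : ZLat d) : ℝ :=
  (lgauge (potential f) K y).toReal

lemma gauge_nonneg (f : ZLat d → ℝ) (K : Set (ZLat d)) (y : ZLat d) : 0 ≤ gauge f K y :=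
  ENNReal.toReal_nonneg

lemma gauge_eq_zero {f : ZLat d → ℝ} {K : Set (ZLat d)} {y : ZLat d} (hy : y ∈ K) :
    gauge f K y = 0 := by
  rw [gauge, lgauge_eq_zero hy, ENNReal.toReal_zero]

lemma nbrAverage_gauge_nonneg (f : ZLat d → ℝ) (K : Set (ZLat d)) (y : ZLat d) :
    0 ≤ nbrAverage (gauge f K) y :=
  le_nbrAverage_of_forall fun _ => gauge_nonneg _ _ _

variable (hd : 3 ≤ d) {f : ZLat d → ℝ} (hf : ∀ y, 0 < f y) (hf1 : {y | f y ≠ 1}.Finite)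
  (K : Set (ZLat d))
include hd hf hf1

lemma gauge_le (y : ZLat d) : gauge f K y ≤ f y := by
  have := ENNReal.toReal_mono ENNReal.ofReal_ne_top (lgauge_le hd hf hf1 K y)
  rwa [ENNReal.toReal_ofReal (hf y).le] at this

lemma ofReal_gauge (y : ZLat d) : ENNReal.ofReal (gauge f K y) = lgauge (potential f) K y :=
  ENNReal.ofReal_toReal (ne_top_of_le_ne_top ENNReal.ofReal_ne_top (lgauge_le hd hf hf1 K y))

lemma lavg_lgauge (y : ZLat d) :
    lavg (lgauge (potential f) K) y = ENNReal.ofReal (nbrAverage (gauge f K) y) := by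
  rw [← lavg_ofReal fun s => gauge_nonneg _ _ _]
  simp only [ofReal_gauge hd hf hf1 K]

lemma gauge_mul_nbrAverage {y : ZLat d} (hy : y ∉ K) :
    gauge f K y * nbrAverage f y = f y * nbrAverage (gauge f K) y := by
  have hp := nbrAverage_pos hf y
  rw [gauge, lgauge_eq_of_notMem (potential_lt_one hf y) hy, lavg_lgauge hd hf hf1 K,
    one_div_one_sub_potential hf, ENNReal.toReal_mul,
    ENNReal.toReal_ofReal (div_nonneg (hf y).le hp.le),
    ENNReal.toReal_ofReal (nbrAverage_gauge_nonneg f K y)]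
  field_simp

lemma tendsto_one_sub_gauge_div (hK : K.Finite) :
    Filter.Tendsto (fun y => 1 - gauge f K y / f y) Filter.cofinite (nhds 0) := by
  obtain ⟨U, hU, h1, h0⟩ := exists_finite_potential_eq_zero hf1
  have hW : (K ∪ U).Finite := hK.union hU
  have hlim : Filter.Tendsto (fun y => ∑ w ∈ hW.toFinset, green d (y - w)) Filter.cofinite
      (nhds 0) := by
    rw [← Finset.sum_const_zero (s := hW.toFinset) (M := ℝ)]
    refine tendsto_finsetSum _ fun w _ => ?_
    exact (tendsto_green hd).comp (sub_left_injective (b := w)).tendsto_cofinite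
  refine tendsto_of_tendsto_of_tendsto_of_le_of_le' tendsto_const_nhds hlim
    (Filter.Eventually.of_forall fun y => ?_) ?_
  · have := (div_le_one (hf y)).2 (gauge_le hd hf hf1 K y)
    linarith
  · have hev : ∀ᶠ y in Filter.cofinite, y ∉ U := Filter.eventually_cofinite.2 (by simpa using hU)
    filter_upwards [hev] with y hy
    have := ofReal_le_lgauge hd hW subset_union_left (V := potential f)
      (fun y hy => h0 y fun hc => hy (Or.inr hc)) y
    rw [← ofReal_gauge hd hf hf1 K, ENNReal.ofReal_le_ofReal_iff (gauge_nonneg _ _ _)] at this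
    rw [h1 y hy, div_one]
    linarith

/-- The tilted equilibrium measure in terms of the gauge function. -/
lemma tiltedEqMeasure_eq {y : ZLat d} (hy : y ∈ K) :
    tiltedEqMeasure f K y = f y * nbrAverage (gauge f K) y := by
  have hp := nbrAverage_pos hf y
  obtain ⟨U, hU, h1, h0⟩ := exists_finite_potential_eq_zero hf1
  have hset : {ω | returnTime K y ω = ⊤} =ᵐ[tiltedMeasure f y] noReturn K y := by
    refine Filter.Eventually.filter_mono
      (withDensity_absolutelyContinuous _ _).ae_le (p := fun ω => _) ?_
    filter_upwards [ae_isRegular (d := d)] with ω h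
    exact propext (h.returnTime_eq_top_iff K y)
  have hw : ∀ᵐ ω ∂sampleMeasure d, ENNReal.ofReal ((1 / f y) *
      Real.exp (∫ s in Set.Ioi (0 : ℝ), potential f (walk y ω s))) =
      ENNReal.ofReal (1 / f y) * totalWeight (potential f) y ω := by
    filter_upwards [ae_isRegular (d := d), ae_eventually_skeleton_notMem hd y hU]
      with ω h ⟨N, hN⟩
    have hN' : ∀ n, N ≤ n → potential f (skeleton y ω n) = 0 := fun n hn => h0 _ (hN n hn)
    rw [h.integral_walk _ y hN', totalWeight_eq hN', pathWeight,
      ENNReal.ofReal_mul (one_div_pos.2 (hf y)).le]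
  rw [tiltedEqMeasure, if_pos hy, measureReal_def, measure_congr hset, tiltedMeasure,
    withDensity_apply _ (measurableSet_noReturn K y),
    lintegral_congr_ae (ae_restrict_of_ae hw), lintegral_const_mul _ (measurable_totalWeight _ _),
    ← lintegral_indicator (measurableSet_noReturn K y),
    lintegral_noReturn _ _ (potential_lt_one hf y), lavg_lgauge hd hf hf1 K,
    one_div_one_sub_potential hf, ENNReal.toReal_mul, ENNReal.toReal_mul,
    ENNReal.toReal_ofReal (one_div_pos.2 (hf y)).le,
    ENNReal.toReal_ofReal (div_nonneg (hf y).le hp.le),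
    ENNReal.toReal_ofReal (nbrAverage_gauge_nonneg f K y)]
  have := (hf y).ne'
  field_simp

/-- The tilted walk avoids `K` with probability close to one, from points `w` around which `f` is
constant in a ball of radius `ρ` disjoint from `K`. -/
lemma one_sub_gauge_div_le (hK : K.Finite) {c C : ℝ} (hc : 0 < c) (hcC : ∀ y, c ≤ f y ∧ f y ≤ C)
    {w : ZLat d} {ρ : ℝ} (hρ : 0 < ρ) (hwK : ∀ y ∈ K, ρ ≤ eucNorm (y - w))
    (hconst : ∀ y, eucNorm (y - w) < ρ → f y = f w ∧ ∀ s, f (y + unitVec s) = f w)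
    {B : ℝ} {t : ℕ} (hB : ∀ N, ∑ n ∈ Finset.range N, heatKernel d (t + t + n) 0 ≤ B)
    {l : ℝ} (hl : 0 < l) :
    1 - gauge f K w / f w ≤
      t / ρ ^ 2 + (1 / 2) * (l * B + l⁻¹ * (C ^ 2 / c ^ 2 * K.ncard)) := by
  refine potential_le hd (φ := fun y => 1 - gauge f K y / f y) hK hc hcC (fun y => ⟨?_, ?_⟩)
    (tendsto_one_sub_gauge_div hd hf hf1 K hK) (fun y hy => ?_) hρ (fun y hy => ?_) hB hl
  · linarith [(div_le_one (hf y)).2 (gauge_le hd hf hf1 K y)]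
  · linarith [div_nonneg (gauge_nonneg f K y) (hf y).le]
  · have hd0 := cast_dim_pos (d := d)
    have e : ∀ s : Fin d × Bool, f y * f (y + unitVec s) *
        (1 - gauge f K y / f y - (1 - gauge f K (y + unitVec s) / f (y + unitVec s))) =
        f y * gauge f K (y + unitVec s) - gauge f K y * f (y + unitVec s) := by
      intro s
      have h1 := (hf y).ne'
      have h2 := (hf (y + unitVec s)).ne'
      field_simp
      ring
    have h2 : ∀ g : ZLat d → ℝ, ∑ s : Fin d × Bool, g (y + unitVec s) = 2 * d * nbrAverage g y := by
      intro g
      rw [nbrAverage]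
      field_simp
    simp only [e, Finset.sum_sub_distrib, ← Finset.mul_sum, h2]
    linear_combination -(2 * (d : ℝ)) * gauge_mul_nbrAverage hd hf hf1 K hy
  · have hyK : y ∉ K := fun hc => absurd hy (not_lt.2 (hwK y hc))
    obtain ⟨h1, h2⟩ := hconst y hy
    have h3 : nbrAverage f y = f w := by
      rw [nbrAverage_congr (h := fun _ => f w) h2, nbrAverage_const]
    have h4 := gauge_mul_nbrAverage hd hf hf1 K hyK
    rw [h3, h1] at h4
    have h5 : gauge f K y = nbrAverage (gauge f K) y :=
      mul_right_cancel₀ (hf w).ne' (h4.trans (mul_comm _ _))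
    rw [nbrAverage_congr (h := fun z => 1 - (f w)⁻¹ * gauge f K z) fun s => by
      rw [h2 s, div_eq_inv_mul]]
    have e : (fun z => 1 - (f w)⁻¹ * gauge f K z) =
        (fun _ => 1) - fun z => (f w)⁻¹ * gauge f K z := rfl
    rw [e, nbrAverage_sub, nbrAverage_const, Pi.sub_apply, nbrAverage_const_mul, ← h5, h1,
      div_eq_inv_mul]

end gauge

/-! ### Lattice norms -/

section norms
variable {d : ℕ}

lemma norm_le_eucNorm (y : ZLat d) : ‖y‖ ≤ eucNorm y := by
  refine (pi_norm_le_iff_of_nonneg (norm_nonneg _)).2 fun i => ?_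
  have h : ((y i : ℝ)) ^ 2 ≤ eucNorm y ^ 2 := by
    rw [eucNorm_sq]
    exact Finset.single_le_sum (f := fun i => (y i : ℝ) ^ 2) (fun _ _ => sq_nonneg _)
      (Finset.mem_univ i)
  rw [Int.norm_eq_abs]
  exact abs_le_of_sq_le_sq h (norm_nonneg _)

lemma finite_box (z : ZLat d) (r : ℝ) : (box z r).Finite := by
  have : box z r = Metric.closedBall z r := by
    ext y
    simp [box, dist_eq_norm]
  rw [this]
  exact isCompact_iff_finite.1 (isCompact_closedBall z r)

lemma eucNorm_add_le (x y : ZLat d) : eucNorm (x + y) ≤ eucNorm x + eucNorm y := by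
  have : toEuc (x + y) = toEuc x + toEuc y := by
    ext i; simp [toEuc]
  rw [eucNorm, this]
  exact norm_add_le _ _

lemma eucNorm_unitVec (s : Fin d × Bool) : eucNorm (unitVec s) = 1 := by
  have : eucNorm (unitVec s) ^ 2 = 1 := by
    rw [eucNorm_sq, Finset.sum_eq_single s.1]
    · rcases s with ⟨i, b⟩
      cases b <;> simp [unitVec]
    · intro i _ hi
      simp [unitVec, hi]
    · simp
  nlinarith [norm_nonneg (toEuc (unitVec s)), (show eucNorm (unitVec s) = ‖toEuc (unitVec s)‖ from rfl)]

lemma eucNorm_add_unitVec_sub_le (y z : ZLat d) (s : Fin d × Bool) :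
    eucNorm (y + unitVec s - z) ≤ eucNorm (y - z) + 1 := by
  rw [add_sub_right_comm]
  exact (eucNorm_add_le _ _).trans (by rw [eucNorm_unitVec])

lemma eucNorm_sub_comm (y z : ZLat d) : eucNorm (y - z) = eucNorm (z - y) := by
  have : toEuc (y - z) = -toEuc (z - y) := by
    ext i; simp [toEuc]
  rw [eucNorm, this, norm_neg]
  rfl

lemma eucNorm_sub_le (x y z : ZLat d) : eucNorm (x - z) ≤ eucNorm (x - y) + eucNorm (y - z) := by
  rw [← sub_add_sub_cancel x y z]
  exact eucNorm_add_le _ _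

end norms

/-! ### Comparison of the tilted and untilted equilibrium measures -/

section comparison
variable {d : ℕ} [NeZero d]

/-- Maximum principle for the simple random walk. -/
lemma maximum_principle {S : Set (ZLat d)} (hS : S.Finite) {D : ZLat d → ℝ}
    (hsub : ∀ y ∈ S, D y ≤ nbrAverage D y)
    (hbd : ∀ y ∈ S, ∀ s, y + unitVec s ∉ S → D (y + unitVec s) ≤ 0) : ∀ y ∈ S, D y ≤ 0 := by
  intro y hy
  obtain ⟨y₀, hy₀, hmax⟩ := exists_max_image S D hS ⟨y, hy⟩
  refine (hmax y hy).trans (not_lt.1 fun hpos => ?_)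
  -- among the maximizers, take one with the largest first coordinate and step to the right
  obtain ⟨y₁, ⟨hy₁, he⟩, hmax'⟩ := exists_max_image {y | y ∈ S ∧ D y = D y₀} (fun y => y 0)
    (hS.subset fun y h => h.1) ⟨y₀, hy₀, rfl⟩
  have hle : ∀ s, D (y₁ + unitVec s) ≤ D y₀ := fun s => by
    by_cases h : y₁ + unitVec s ∈ S
    · exact hmax _ h
    · exact (hbd _ hy₁ s h).trans hpos.le
  set s₀ : Fin d × Bool := (0, true)
  have hlt : D (y₁ + unitVec s₀) < D y₀ := by
    refine lt_of_le_of_ne (hle s₀) fun heq => ?_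
    have hmem : y₁ + unitVec s₀ ∈ S := by
      by_contra h
      have := hbd _ hy₁ s₀ h
      linarith
    have := hmax' _ ⟨hmem, heq⟩
    simp [s₀, unitVec] at this
  have hd := cast_dim_pos (d := d)
  have h1 : nbrAverage D y₁ < nbrAverage (fun _ => D y₀) y₁ :=
    mul_lt_mul_of_pos_left (Finset.sum_lt_sum (fun s _ => hle s) ⟨s₀, Finset.mem_univ _, hlt⟩)
      (by positivity)
  rw [nbrAverage_const] at h1
  linarith [hsub y₁ hy₁]

lemma eqMeasure_eq_tiltedEqMeasure_one (K : Set (ZLat d)) (y : ZLat d) :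
    eqMeasure K y = tiltedEqMeasure (fun _ => 1) K y := by
  have h : tiltedMeasure (fun _ : ZLat d => (1 : ℝ)) y = sampleMeasure d := by
    rw [tiltedMeasure]
    have : ∀ z : ZLat d, potential (fun _ => 1) z = 0 := fun z => by simp [potential]
    simp [this]
  simp [eqMeasure, tiltedEqMeasure, h, nbrAverage_const]

/-- If the walk and the tilted walk avoid `K` with probability at least `1 - e` from the boundary
of a ball on which `f` is constant, then their equilibrium measures are comparable. -/
theorem tiltedEqMeasure_comparison (hd : 3 ≤ d) {f : ZLat d → ℝ} (hf : ∀ y, 0 < f y)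
    (hf1 : {y | f y ≠ 1}.Finite) {K : Set (ZLat d)} {z : ZLat d} {R e : ℝ} (hR : 8 ≤ R)
    (he : e ≤ 1) (hconst : ∀ y, eucNorm (y - z) ≤ R → f y = f z)
    (hK : ∀ y ∈ K, eucNorm (y - z) ≤ R / 8)
    (hG : ∀ w, R / 2 ≤ eucNorm (w - z) → eucNorm (w - z) ≤ R / 2 + 1 →
      1 - gauge f K w / f w ≤ e ∧ 1 - gauge (fun _ => 1) K w ≤ e) (y : ZLat d) :
    (1 - e) * (f z ^ 2 * eqMeasure K y) ≤ tiltedEqMeasure f K y ∧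
      (1 - e) * tiltedEqMeasure f K y ≤ f z ^ 2 * eqMeasure K y := by
  have hone : ∀ y : ZLat d, (0 : ℝ) < (fun _ => 1 : ZLat d → ℝ) y := fun _ => one_pos
  have hone1 : {y : ZLat d | (fun _ => 1 : ZLat d → ℝ) y ≠ 1}.Finite := by simp
  rw [eqMeasure_eq_tiltedEqMeasure_one]
  by_cases hy : y ∈ K
  swap
  · simp [tiltedEqMeasure, hy]
  rw [tiltedEqMeasure_eq hd hf hf1 K hy, tiltedEqMeasure_eq hd hone hone1 K hy]
  set h := gauge (fun _ => 1) K with hh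
  set G := gauge f K with hGdef
  have hKz := hK y hy
  have fy : f y = f z := hconst y (by linarith)
  have hfz := hf z
  set S : Set (ZLat d) := {w | eucNorm (w - z) < R / 2} \ K with hS
  have hSfin : S.Finite := (finite_box z (R / 2)).subset fun w hw =>
    (norm_le_eucNorm _).trans hw.1.le
  have harm : ∀ w ∈ S, nbrAverage G w = G w ∧ nbrAverage h w = h w := by
    intro w hw
    have hw1 : eucNorm (w - z) < R / 2 := hw.1
    have e1 := gauge_mul_nbrAverage hd hf hf1 K hw.2
    have e2 := gauge_mul_nbrAverage hd hone hone1 K hw.2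
    have e3 : nbrAverage f w = f z := by
      rw [nbrAverage_congr (h := fun _ => f z) fun s => hconst _
        ((eucNorm_add_unitVec_sub_le w z s).trans (by linarith)), nbrAverage_const]
    rw [e3, hconst w (by linarith), mul_comm] at e1
    rw [nbrAverage_const, mul_one, one_mul] at e2
    exact ⟨(mul_left_cancel₀ hfz.ne' e1).symm, e2.symm⟩
  have hbdry : ∀ w ∈ S, ∀ s, w + unitVec s ∉ S → w + unitVec s ∈ K ∨
      (G (w + unitVec s) ≤ f z ∧ (1 - e) * f z ≤ G (w + unitVec s) ∧
        h (w + unitVec s) ≤ 1 ∧ 1 - e ≤ h (w + unitVec s)) := by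
    intro w hw s hws
    by_cases hk : w + unitVec s ∈ K
    · exact Or.inl hk
    right
    have hw1 : eucNorm (w - z) < R / 2 := hw.1
    have h1 : R / 2 ≤ eucNorm (w + unitVec s - z) := not_lt.1 fun hc => hws ⟨hc, hk⟩
    have h2 : eucNorm (w + unitVec s - z) ≤ R / 2 + 1 :=
      (eucNorm_add_unitVec_sub_le w z s).trans (by linarith)
    have h3 := hconst (w + unitVec s) (by linarith)
    obtain ⟨g1, g2⟩ := hG _ h1 h2
    have g3 := gauge_le hd hf hf1 K (w + unitVec s)
    have g4 := gauge_le hd hone hone1 K (w + unitVec s)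
    rw [h3] at g1 g3
    refine ⟨g3, ?_, g4, by linarith⟩
    rw [← le_div_iff₀ hfz]
    linarith
  have cmp : ∀ w, eucNorm (w - z) < R / 2 →
      (1 - e) * f z * h w ≤ G w ∧ (1 - e) * G w ≤ f z * h w := by
    intro w hw
    by_cases hk : w ∈ K
    · rw [hh, hGdef, gauge_eq_zero hk, gauge_eq_zero hk]
      simp
    have hwS : w ∈ S := ⟨hw, hk⟩
    constructor
    · have := maximum_principle hSfin (D := (fun w => (1 - e) * f z * h w) - G)
        (fun w hw => by
          rw [nbrAverage_sub, Pi.sub_apply, Pi.sub_apply, nbrAverage_const_mul, (harm w hw).1,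
            (harm w hw).2])
        (fun w hw s hs => by
          rw [Pi.sub_apply]
          rcases hbdry w hw s hs with hk | ⟨b1, b2, b3, b4⟩
          · rw [hh, hGdef, gauge_eq_zero hk, gauge_eq_zero hk]
            simp
          · have : (1 - e) * f z * h (w + unitVec s) ≤ (1 - e) * f z * 1 :=
              mul_le_mul_of_nonneg_left b3 (mul_nonneg (by linarith) hfz.le)
            linarith) w hwS
      rw [Pi.sub_apply] at this
      linarith
    · have := maximum_principle hSfin (D := (fun w => (1 - e) * G w) - fun w => f z * h w)
        (fun w hw => by
          rw [nbrAverage_sub, Pi.sub_apply, Pi.sub_apply, nbrAverage_const_mul,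
            nbrAverage_const_mul, (harm w hw).1, (harm w hw).2])
        (fun w hw s hs => by
          rw [Pi.sub_apply]
          rcases hbdry w hw s hs with hk | ⟨b1, b2, b3, b4⟩
          · rw [hh, hGdef, gauge_eq_zero hk, gauge_eq_zero hk]
            simp
          · have h1 : (1 - e) * G (w + unitVec s) ≤ (1 - e) * f z :=
              mul_le_mul_of_nonneg_left b1 (by linarith)
            have h2 : f z * (1 - e) ≤ f z * h (w + unitVec s) :=
              mul_le_mul_of_nonneg_left b4 hfz.le
            linarith) w hwS
      rw [Pi.sub_apply] at this
      linarith
  have hnbr : ∀ s, eucNorm (y + unitVec s - z) < R / 2 := fun s =>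
    (eucNorm_add_unitVec_sub_le y z s).trans_lt (by linarith)
  have c1 := nbrAverage_mono (g := fun w => (1 - e) * f z * h w) (h := G)
    fun s => (cmp _ (hnbr s)).1
  have c2 := nbrAverage_mono (g := fun w => (1 - e) * G w) (h := fun w => f z * h w)
    fun s => (cmp _ (hnbr s)).2
  rw [nbrAverage_const_mul] at c1
  rw [nbrAverage_const_mul, nbrAverage_const_mul] at c2
  rw [fy]
  simp only [one_mul]
  constructor
  · calc _ = f z * ((1 - e) * f z * nbrAverage h y) := by ring
      _ ≤ _ := mul_le_mul_of_nonneg_left c1 hfz.le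
  · calc _ = f z * ((1 - e) * nbrAverage G y) := by ring
      _ ≤ f z * (f z * nbrAverage h y) := mul_le_mul_of_nonneg_left c2 hfz.le
      _ = _ := by ring

/-- Choice of the time `t` and of the weight `l` in `one_sub_gauge_div_le`, for sets of at most
`(3s)^d` points and a ball of radius of the order of `s¹⁶`. -/
lemma exists_error_le (hd : 3 ≤ d) {κ e : ℝ} (hκ : 0 ≤ κ) (he : 0 < e) :
    ∃ s₀ : ℝ, 1 ≤ s₀ ∧ ∀ s, s₀ ≤ s → ∀ n : ℕ, (n : ℝ) ≤ (3 * s) ^ d →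
      ∃ (t : ℕ) (B l : ℝ), 0 < l ∧
        (∀ N, ∑ n ∈ Finset.range N, heatKernel d (t + t + n) 0 ≤ B) ∧
        t / (s ^ 16 / 4) ^ 2 + (1 / 2) * (l * B + l⁻¹ * (κ * n)) ≤ e := by
  obtain ⟨A, hA, hB⟩ := exists_heatKernel_tail_le d hd
  have hd' : (3 : ℝ) ≤ d := by exact_mod_cast hd
  set M : ℝ := 32 + A + κ * 3 ^ d with hM
  have hM0 : 0 < M := by positivity
  refine ⟨max 1 ((M / e) ^ 2), le_max_left _ _, fun s hs n hn => ?_⟩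
  have hs1 : 1 ≤ s := (le_max_left _ _).trans hs
  have hs0 : 0 < s := by linarith
  have hpow : 1 ≤ s ^ 16 := one_le_pow₀ hs1
  set t := ⌈s ^ 16⌉₊ with ht
  have ht1 : s ^ 16 ≤ t := Nat.le_ceil _
  have ht2 : (t : ℝ) ≤ 2 * s ^ 16 := by
    have := (Nat.ceil_lt_add_one (show 0 ≤ s ^ 16 by positivity)).le
    linarith
  have ht0 : 0 < t := Nat.ceil_pos.2 (by linarith)
  have hr := Real.sqrt_pos.2 hs0
  have hrM : M / e ≤ √s := Real.le_sqrt_of_sq_le ((le_max_right _ _).trans hs)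
  have hrs : √s ≤ s ^ 16 := by
    have h1 : √s ≤ s := Real.sqrt_le_iff.2 ⟨hs0.le, by nlinarith⟩
    exact h1.trans (le_self_pow₀ hs1 (by norm_num))
  refine ⟨t, _, s ^ d * √s, by positivity, fun N => hB (t + t) N (by omega) 0, ?_⟩
  have e1 : (t : ℝ) / (s ^ 16 / 4) ^ 2 ≤ 32 / √s := by
    calc (t : ℝ) / (s ^ 16 / 4) ^ 2 ≤ 2 * s ^ 16 / (s ^ 16 / 4) ^ 2 := by gcongr
      _ = 32 / s ^ 16 := by field_simp; norm_num
      _ ≤ 32 / √s := by gcongr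
  have e2 : s ^ d * √s * (A * (((t + t : ℕ) : ℝ)) ^ (-((d : ℝ) / 2 - 5 / 4))) ≤ A / √s := by
    have h1 : (((t + t : ℕ) : ℝ)) ^ (-((d : ℝ) / 2 - 5 / 4)) ≤
        (s ^ 16) ^ (-((d : ℝ) / 2 - 5 / 4)) := by
      refine Real.rpow_le_rpow_of_nonpos (by positivity) ?_ (by linarith)
      push_cast
      linarith
    have h2 : (s ^ 16) ^ (-((d : ℝ) / 2 - 5 / 4)) = s ^ (20 - 8 * (d : ℝ)) := by
      rw [← Real.rpow_natCast, ← Real.rpow_mul hs0.le]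
      congr 1
      push_cast
      ring
    have h3 : s ^ d * √s * s ^ (20 - 8 * (d : ℝ)) * √s ≤ 1 := by
      have : s ^ d * √s * s ^ (20 - 8 * (d : ℝ)) * √s = s ^ (21 - 7 * (d : ℝ)) := by
        rw [Real.sqrt_eq_rpow, ← Real.rpow_natCast, ← Real.rpow_add hs0, ← Real.rpow_add hs0,
          ← Real.rpow_add hs0]
        congr 1
        ring
      rw [this]
      exact Real.rpow_le_one_of_one_le_of_nonpos hs1 (by linarith)
    rw [le_div_iff₀ hr]
    calc _ ≤ s ^ d * √s * (A * s ^ (20 - 8 * (d : ℝ))) * √s := by rw [← h2]; gcongr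
      _ = A * (s ^ d * √s * s ^ (20 - 8 * (d : ℝ)) * √s) := by ring
      _ ≤ A * 1 := by gcongr
      _ = A := mul_one A
  have e3 : (s ^ d * √s)⁻¹ * (κ * n) ≤ κ * 3 ^ d / √s := by
    calc _ ≤ (s ^ d * √s)⁻¹ * (κ * (3 * s) ^ d) := by gcongr
      _ = _ := by rw [mul_pow]; field_simp
  have e4 : M / √s ≤ e := by
    rw [div_le_iff₀ hr]
    rw [div_le_iff₀ he] at hrM
    linarith
  have e5 : M / √s = 32 / √s + A / √s + κ * 3 ^ d / √s := by rw [hM]; ring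
  have p1 : 0 ≤ A / √s := by positivity
  have p2 : 0 ≤ κ * 3 ^ d / √s := by positivity
  linarith

end comparison

/-! ### Geometry of the tubes and values of the profile function -/

section tubes
variable {d : ℕ}

lemma dist_toEuc (y z : ZLat d) : dist (toEuc y) (toEuc z) = eucNorm (y - z) := by
  have : toEuc (y - z) = toEuc y - toEuc z := by
    ext i; simp [toEuc]
  rw [eucNorm, this, dist_eq_norm]

lemma ncard_box_le (z : ZLat d) {r s : ℝ} (hrs : r ≤ s) (hs : 1 ≤ s) :
    ((box z r).ncard : ℝ) ≤ (3 * s) ^ d := by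
  have hsub : box z r ⊆ (Fintype.piFinset fun i => Finset.Icc (z i - ⌊s⌋) (z i + ⌊s⌋) :
      Finset (ZLat d)) := by
    intro y hy
    simp only [Finset.mem_coe, Fintype.mem_piFinset, Finset.mem_Icc]
    intro i
    have h1 : ‖(y - z) i‖ ≤ s := (norm_le_pi_norm _ i).trans (le_trans hy hrs)
    rw [Int.norm_eq_abs] at h1
    have h2 : |(y - z) i| ≤ ⌊s⌋ := Int.le_floor.2 (by rw [Int.cast_abs]; exact h1)
    rw [Pi.sub_apply, abs_le] at h2
    constructor <;> linarith [h2.1, h2.2]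
  have h1 := Set.ncard_le_ncard hsub (Finset.finite_toSet _)
  rw [Set.ncard_coe_finset, Fintype.card_piFinset] at h1
  have h2 : ∀ i : Fin d, ((Finset.Icc (z i - ⌊s⌋) (z i + ⌊s⌋)).card : ℝ) ≤ 3 * s := by
    intro i
    rw [Int.card_Icc]
    have h0 : 0 ≤ ⌊s⌋ := Int.floor_nonneg.2 (by linarith)
    have h3 : (((z i + ⌊s⌋ + 1 - (z i - ⌊s⌋)).toNat : ℤ) : ℝ) = 2 * ⌊s⌋ + 1 := by
      rw [Int.toNat_of_nonneg (by linarith)]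
      push_cast
      ring
    have h4 : (((z i + ⌊s⌋ + 1 - (z i - ⌊s⌋)).toNat : ℕ) : ℝ) = 2 * ⌊s⌋ + 1 := by
      rw [← h3]; push_cast; rfl
    rw [h4]
    linarith [Int.floor_le s]
  calc ((box z r).ncard : ℝ) ≤ ((∏ i : Fin d, (Finset.Icc (z i - ⌊s⌋) (z i + ⌊s⌋)).card : ℕ) : ℝ) :=
        by exact_mod_cast h1
    _ ≤ ∏ _i : Fin d, 3 * s := by
        rw [Nat.cast_prod]
        exact Finset.prod_le_prod (fun _ _ => Nat.cast_nonneg _) fun i _ => h2 i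
    _ = (3 * s) ^ d := by simp

lemma eucNorm_le_of_mem_box {y z : ZLat d} {r : ℝ} (hy : y ∈ box z r) : eucNorm (y - z) ≤ d * r := by
  have hr : 0 ≤ r := (norm_nonneg _).trans hy
  refine abs_le_of_sq_le_sq' ?_ (by positivity) |>.2
  rw [eucNorm_sq]
  calc ∑ i, (((y - z) i : ℤ) : ℝ) ^ 2 ≤ ∑ _i : Fin d, r ^ 2 := by
        refine Finset.sum_le_sum fun i _ => ?_
        have h1 : ‖(y - z) i‖ ≤ r := (norm_le_pi_norm _ i).trans hy
        rw [Int.norm_eq_abs] at h1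
        exact sq_le_sq' (by linarith [(abs_le.1 h1).1]) (abs_le.1 h1).2
    _ = d * r ^ 2 := by simp
    _ ≤ (d * r) ^ 2 := by
        rw [mul_pow]
        gcongr
        rcases Nat.eq_zero_or_pos d with h | h
        · simp [h]
        · exact le_self_pow₀ (by exact_mod_cast h) (by norm_num)

/-- Distance to the discretized segment `T(x)`. -/
noncomputable def segDist (rnd : EuclideanSpace ℝ (Fin d) → ZLat d) (x y : ZLat d) : ℝ :=
  Metric.infDist (toEuc y) (toEuc '' discSegment rnd x)

variable {rnd : EuclideanSpace ℝ (Fin d) → ZLat d} {x : ZLat d}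

lemma segDist_le_add (y z : ZLat d) : segDist rnd x y ≤ segDist rnd x z + eucNorm (y - z) := by
  rw [← dist_toEuc]
  exact Metric.infDist_le_infDist_add_dist

lemma segDist_eq_zero {y : ZLat d} (hy : y ∈ discSegment rnd x) : segDist rnd x y = 0 :=
  Metric.infDist_zero_of_mem (mem_image_of_mem _ hy)

lemma eucNorm_le_of_mem_discSegment (hr : IsLatticeRounding rnd) (hx : 0 < eucNorm x) {y : ZLat d}
    (hy : y ∈ discSegment rnd x) : eucNorm y ≤ 2 * (eucNorm x + 1) := by
  obtain ⟨j, hj, rfl⟩ := hy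
  set p := (j : ℝ) • ((eucNorm x)⁻¹ • toEuc x) with hp
  have hpn : ‖p‖ = j := by
    rw [hp, norm_smul, norm_smul, norm_inv, Real.norm_of_nonneg hx.le]
    change ‖(j : ℝ)‖ * ((eucNorm x)⁻¹ * eucNorm x) = j
    rw [inv_mul_cancel₀ hx.ne', mul_one]
    simp
  have hj' : (j : ℝ) ≤ eucNorm x + 1 := by
    have h1 : (j : ℝ) ≤ (⌈eucNorm x⌉₊ : ℝ) := by exact_mod_cast hj
    linarith [Nat.ceil_lt_add_one hx.le]
  have h0 : toEuc (0 : ZLat d) = 0 := by ext i; simp [toEuc]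
  have h1 : dist p (toEuc (rnd p)) ≤ ‖p‖ := by
    rw [hr p]
    have := Metric.infDist_le_dist_of_mem (x := p) (mem_range_self (f := toEuc (d := d)) 0)
    rwa [h0, dist_zero_right] at this
  have h2 : eucNorm (rnd p) ≤ ‖p‖ + dist p (toEuc (rnd p)) := by
    rw [dist_comm, dist_eq_norm]
    exact norm_le_insert' _ _
  linarith

lemma eucNorm_le_of_segDist_le (hr : IsLatticeRounding rnd) (hx : 0 < eucNorm x) (y : ZLat d) :
    eucNorm y ≤ segDist rnd x y + 2 * eucNorm x + 3 := by
  have hne : (toEuc '' discSegment rnd x).Nonempty := ⟨_, mem_image_of_mem _ ⟨0, Nat.zero_le _, rfl⟩⟩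
  obtain ⟨_, ⟨w, hw, rfl⟩, hlt⟩ := (Metric.infDist_lt_iff hne).1 (lt_add_one (segDist rnd x y))
  rw [dist_toEuc] at hlt
  have h1 := eucNorm_le_of_mem_discSegment hr hx hw
  have h2 := eucNorm_add_le (y - w) w
  rw [sub_add_cancel] at h2
  linarith

variable {δ : ℝ}

/-- The tubes and the box `U` on the scale `s = |x|^{δ/8}`: the tube `T^i` has radius `s^{8i}`. -/
lemma tube_scales (hδ : δ ∈ Set.Ioo (0 : ℝ) (1 / 6)) (hr : IsLatticeRounding rnd) {s : ℝ}
    (hs : s = eucNorm x ^ (δ / 8)) (hx : 100 ≤ eucNorm x) :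
    (∀ i y, y ∈ tubeT rnd δ x i ↔ segDist rnd x y ≤ s ^ (8 * i)) ∧
    (∀ y, y ∈ tubeT6 rnd δ x ↔ segDist rnd x y ≤ 4 * s ^ 40) ∧
    tubeT6 rnd δ x ⊆ bigBox x := by
  have hx0 : 0 < eucNorm x := by linarith
  have hpow : ∀ i : ℕ, eucNorm x ^ ((i : ℝ) * δ) = s ^ (8 * i) := by
    intro i
    rw [hs, ← Real.rpow_natCast, ← Real.rpow_mul hx0.le]
    congr 1
    push_cast
    ring
  have h5 : eucNorm x ^ (5 * δ) = s ^ 40 := by simpa using hpow 5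
  refine ⟨fun i y => ?_, fun y => ?_, fun y hy => ?_⟩
  · rw [tubeT, max_eq_left hx, hpow]
    rfl
  · rw [tubeT6, max_eq_left hx, h5]
    rfl
  · rw [tubeT6, max_eq_left hx] at hy
    have h1 : segDist rnd x y ≤ 4 * eucNorm x ^ (5 * δ) := hy
    have h2 : eucNorm x ^ (5 * δ) ≤ eucNorm x := by
      conv_rhs => rw [← Real.rpow_one (eucNorm x)]
      exact Real.rpow_le_rpow_of_exponent_le (by linarith) (by linarith [hδ.2])
    have h3 := eucNorm_le_of_segDist_le hr hx0 y
    have h4 := norm_le_eucNorm y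
    simp only [bigBox, box, sub_zero, mem_ofPred_eq]
    linarith

/-- On the scale `s = |x|^{δ/8}` the boxes `B_i^z` with `i ≤ 2` have radius at most `s`. -/
lemma exists_boxB_eq_box {s : ℝ} (hs : s = eucNorm x ^ (δ / 8)) (hx : 100 ≤ eucNorm x)
    (hs10 : 10 ≤ s) (z : ZLat d) {i : ℕ} (hi : i ≤ 2) : ∃ r ≤ s, boxB δ x i z = box z r := by
  refine ⟨_, ?_, rfl⟩
  have hx0 : 0 < eucNorm x := by linarith
  have hq : eucNorm x ^ δ = s ^ 8 := by
    rw [hs, ← Real.rpow_natCast, ← Real.rpow_mul hx0.le]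
    congr 1
    push_cast
    ring
  have hs8 : (10 : ℝ) ^ 8 ≤ s ^ 8 := by gcongr
  have h1 : radiusOne δ x ≤ s ^ 2 := by
    rw [radiusOne, hq]
    calc (max 100 (s ^ 8 / 100)) ^ (1 / 4 : ℝ) ≤ (s ^ 8) ^ (1 / 4 : ℝ) := by
          gcongr
          refine max_le ?_ ?_ <;> linarith
      _ = s ^ 2 := by
          rw [← Real.rpow_natCast, ← Real.rpow_mul (by linarith), ← Real.rpow_natCast]
          norm_num
  have h2 : 1 ≤ radiusOne δ x :=
    Real.one_le_rpow (le_max_of_le_left (by norm_num)) (by norm_num)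
  have hi' : (i : ℝ) ≤ 2 := by exact_mod_cast hi
  calc radiusOne δ x ^ (((i : ℝ) + 2) / 8) ≤ radiusOne δ x ^ (1 / 2 : ℝ) :=
        Real.rpow_le_rpow_of_exponent_le h2 (by linarith)
    _ ≤ (s ^ 2) ^ (1 / 2 : ℝ) := by gcongr
    _ = s := by rw [← Real.sqrt_eq_rpow, Real.sqrt_sq (by linarith)]

end tubes

section profile
variable {d : ℕ} [NeZero d] {rnd : EuclideanSpace ℝ (Fin d) → ZLat d} {δ : ℝ} {x : ZLat d}
  {u v ε : ℝ}

lemma profile_eq_int {y : ZLat d} (h2 : y ∈ tubeT rnd δ x 2) (h3 : y ∈ tubeT rnd δ x 3)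
    (h6 : y ∈ tubeT6 rnd δ x) (hU : y ∈ bigBox x) :
    profile rnd δ x u v ε y = √((criticalLevel d - ε) / u) := by
  rw [profile, hitBeforeExit_eq_one h6 hU, hitBeforeExit_eq_one h2 h3]
  ring

lemma profile_eq_ext {y : ZLat d} (h3 : y ∉ tubeT rnd δ x 3) (h6 : y ∈ tubeT6 rnd δ x)
    (hU : y ∈ bigBox x) : profile rnd δ x u v ε y = √((criticalLevel d + ε) / v) := by
  rw [profile, hitBeforeExit_eq_one h6 hU, hitBeforeExit_eq_zero h3]
  ring

lemma profile_eq_one {y : ZLat d} (h3 : y ∉ tubeT rnd δ x 3) (hU : y ∉ bigBox x) :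
    profile rnd δ x u v ε y = 1 := by
  rw [profile, hitBeforeExit_eq_zero hU, hitBeforeExit_eq_zero h3]
  ring

/-- The profile function is a convex combination of `1` and the two square roots. -/
lemma profile_mem_Icc (h36 : tubeT rnd δ x 3 ⊆ tubeT6 rnd δ x) (h6U : tubeT6 rnd δ x ⊆ bigBox x)
    {c C : ℝ} (h1 : 1 ∈ Icc c C) (ha : √((criticalLevel d + ε) / v) ∈ Icc c C)
    (hb : √((criticalLevel d - ε) / u) ∈ Icc c C) (y : ZLat d) :
    profile rnd δ x u v ε y ∈ Icc c C := by
  set a := √((criticalLevel d + ε) / v) with hadef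
  set b := √((criticalLevel d - ε) / u) with hbdef
  have conv : ∀ p q t : ℝ, p ∈ Icc c C → q ∈ Icc c C → t ∈ Icc (0 : ℝ) 1 →
      (1 - t) * p + t * q ∈ Icc c C := fun p q t hp hq ht =>
    (convex_Icc c C) hp hq (by linarith [ht.2]) ht.1 (by ring)
  by_cases h6 : y ∈ tubeT6 rnd δ x
  · have e : profile rnd δ x u v ε y = (1 - hitBeforeExit (tubeT rnd δ x 2) (tubeT rnd δ x 3) y) * a
        + hitBeforeExit (tubeT rnd δ x 2) (tubeT rnd δ x 3) y * b := by
      rw [profile, hitBeforeExit_eq_one h6 (h6U h6)]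
      ring
    rw [e]
    exact conv _ _ _ ha hb (hitBeforeExit_mem_Icc _ _ _)
  · have e : profile rnd δ x u v ε y = (1 - hitBeforeExit (tubeT6 rnd δ x) (bigBox x) y) * 1
        + hitBeforeExit (tubeT6 rnd δ x) (bigBox x) y * a := by
      rw [profile, hitBeforeExit_eq_zero (A := tubeT rnd δ x 2) fun h => h6 (h36 h)]
      ring
    rw [e]
    exact conv _ _ _ h1 ha (hitBeforeExit_mem_Icc _ _ _)

end profile

section main
variable {d : ℕ} [NeZero d]

/-- Comparison of equilibrium measures for a function `f` that is constant in the ball of radius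
`s¹⁶` around `z` and a set `K` in the box of radius `s` around `z`. -/
lemma exists_scale_comparison (hd : 3 ≤ d) {c C e : ℝ} (hc : 0 < c) (h1 : 1 ∈ Icc c C)
    (he : 0 < e) (he1 : e ≤ 1) :
    ∃ s₀ : ℝ, 10 ≤ s₀ ∧ ∀ s, s₀ ≤ s → ∀ f : ZLat d → ℝ, (∀ y, f y ∈ Icc c C) →
      {y | f y ≠ 1}.Finite → ∀ z, (∀ y, eucNorm (y - z) ≤ s ^ 16 → f y = f z) →
      ∀ r ≤ s, ∀ y,
      (1 - e) * (f z ^ 2 * eqMeasure (box z r) y) ≤ tiltedEqMeasure f (box z r) y ∧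
      (1 - e) * tiltedEqMeasure f (box z r) y ≤ f z ^ 2 * eqMeasure (box z r) y := by
  obtain ⟨s₀, hs₀, herr⟩ := exists_error_le hd (show 0 ≤ C ^ 2 / c ^ 2 by positivity) he
  refine ⟨max (max 10 s₀) (8 * d), le_max_of_le_left (le_max_left _ _),
    fun s hs f hf hf1 z hconst r hrs => ?_⟩
  have hs10 : 10 ≤ s := (le_max_of_le_left (le_max_left _ _)).trans hs
  have hss₀ : s₀ ≤ s := (le_max_of_le_left (le_max_right _ _)).trans hs
  have hsd : 8 * (d : ℝ) ≤ s := (le_max_right _ _).trans hs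
  have hfpos : ∀ y, 0 < f y := fun y => hc.trans_le (hf y).1
  have hs2 : s * s ≤ s ^ 16 := by
    rw [← sq]; exact pow_le_pow_right₀ (by linarith) (by norm_num)
  have hs16 : 100 ≤ s ^ 16 := by nlinarith
  have hK : ∀ y ∈ box z r, eucNorm (y - z) ≤ s ^ 16 / 8 := by
    intro y hy
    refine (eucNorm_le_of_mem_box hy).trans ?_
    have : (d : ℝ) * r ≤ d * s := by gcongr
    nlinarith
  obtain ⟨t, B, l, hl, hB, hbound⟩ := herr s hss₀ _ (ncard_box_le z hrs (by linarith))
  refine tiltedEqMeasure_comparison hd hfpos hf1 (R := s ^ 16) (by linarith) he1 hconst hK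
    fun w hw1 hw2 => ?_
  have hfar : ∀ y ∈ box z r, s ^ 16 / 4 ≤ eucNorm (y - w) := by
    intro y hy
    have h2 := eucNorm_sub_le w y z
    rw [eucNorm_sub_comm w y] at h2
    linarith [hK y hy]
  have hnear : ∀ y, eucNorm (y - w) < s ^ 16 / 4 → f y = f w ∧ ∀ s, f (y + unitVec s) = f w := by
    intro y hy
    have h2 := eucNorm_sub_le y w z
    have hw : f w = f z := hconst w (by linarith)
    refine ⟨(hconst y (by linarith)).trans hw.symm, fun s => (hconst _ ?_).trans hw.symm⟩
    have := eucNorm_add_unitVec_sub_le y z s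
    linarith
  refine ⟨(one_sub_gauge_div_le hd hfpos hf1 _ (finite_box z r) hc hf (by positivity) hfar hnear
    hB hl).trans hbound, ?_⟩
  have := (one_sub_gauge_div_le hd (f := fun _ => 1) (fun _ => one_pos) (by simp) _
    (finite_box z r) hc (fun _ => h1) (by positivity) hfar (fun _ _ => ⟨rfl, fun _ => rfl⟩)
    hB hl).trans hbound
  simpa using this

lemma capacity_comparison {K : Set (ZLat d)} (hK : K.Finite) {f : ZLat d → ℝ} {a e : ℝ}
    (h : ∀ y, (1 - e) * (a * eqMeasure K y) ≤ tiltedEqMeasure f K y ∧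
      (1 - e) * tiltedEqMeasure f K y ≤ a * eqMeasure K y) :
    (1 - e) * (a * capacity K) ≤ tiltedCapacity f K ∧
      (1 - e) * tiltedCapacity f K ≤ a * capacity K := by
  have h1 : capacity K = ∑ y ∈ hK.toFinset, eqMeasure K y :=
    tsum_eq_sum fun y hy => by
      have : y ∉ K := by simpa using hy
      simp [eqMeasure, this]
  have h2 : tiltedCapacity f K = ∑ y ∈ hK.toFinset, tiltedEqMeasure f K y :=
    tsum_eq_sum fun y hy => by
      have : y ∉ K := by simpa using hy
      simp [tiltedEqMeasure, this]
  rw [h1, h2]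
  simp only [Finset.mul_sum]
  exact ⟨Finset.sum_le_sum fun y _ => (h y).1, Finset.sum_le_sum fun y _ => (h y).2⟩

/-- From the factor `1/(1-e)` to the factor `1 + e₀`, for `e = e₀/2`. -/
lemma sandwich_mul {e₀ w a E Et : ℝ} (he₀ : e₀ ∈ Ioo (0 : ℝ) 1) (hw : 0 ≤ w) (hE : 0 ≤ a * E)
    (h1 : (1 - e₀ / 2) * (a * E) ≤ Et) (h2 : (1 - e₀ / 2) * Et ≤ a * E) :
    (1 - e₀) * (a * w * E) ≤ w * Et ∧ w * Et ≤ (1 + e₀) * (a * w * E) := by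
  obtain ⟨h0, h3⟩ := he₀
  have h4 : (1 - e₀) * (a * E) ≤ Et := by nlinarith
  have h5 : Et ≤ (1 + e₀) * (a * E) := by
    -- `(1 + e₀) (1 - e₀ / 2) ≥ 1`
    refine le_of_mul_le_mul_left (h2.trans ?_) (show 0 < 1 - e₀ / 2 by linarith)
    nlinarith [mul_nonneg (mul_nonneg h0.le (sub_nonneg.2 h3.le)) hE]
  constructor
  · calc _ = w * ((1 - e₀) * (a * E)) := by ring
      _ ≤ _ := mul_le_mul_of_nonneg_left h4 hw
  · calc _ ≤ w * ((1 + e₀) * (a * E)) := mul_le_mul_of_nonneg_left h5 hw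
      _ = _ := by ring

lemma eqMeasure_nonneg (K : Set (ZLat d)) (y : ZLat d) : 0 ≤ eqMeasure K y := by
  unfold eqMeasure
  split_ifs
  exacts [measureReal_nonneg, le_rfl]

lemma capacity_nonneg (K : Set (ZLat d)) : 0 ≤ capacity K := tsum_nonneg fun y => eqMeasure_nonneg K y

end main
end TiltedWalk

open TiltedWalk
theorem proposition7p3 (d : ℕ) [NeZero d] (hd : 3 ≤ d)
    (ε₀ : ℝ) (hε₀ : ε₀ ∈ Set.Ioo (0 : ℝ) 1)
    (δ : ℝ) (hδ : δ ∈ Set.Ioo (0 : ℝ) (1 / 6))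
    (ε : ℝ) (hε : ε ∈ Set.Ioo (0 : ℝ) (min (criticalLevel d / 10) 1))
    (u v : ℝ) (hv : 0 < v) (hvu : v ≤ u) :
    ∃ C : ℝ, 0 < C ∧
      ∀ rnd : EuclideanSpace ℝ (Fin d) → ZLat d, IsLatticeRounding rnd →
      ∀ x : ZLat d, C ≤ eucNorm x →
      ∀ z ∈ gammaInt rnd x ∪ gammaExt rnd δ x,
        -- the values of the effective level
        (z ∈ gammaInt rnd x → levelTilde rnd x u v z = u ∧
          level rnd δ x u v ε z = criticalLevel d - ε) ∧
        (z ∈ gammaExt rnd δ x → levelTilde rnd x u v z = v ∧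
          level rnd δ x u v ε z = criticalLevel d + ε) ∧
        -- comparison of capacities
        (1 - ε₀) * (level rnd δ x u v ε z * capacity (boxB δ x 2 z)) ≤
          levelTilde rnd x u v z * tiltedCapacity (profile rnd δ x u v ε) (boxB δ x 2 z) ∧
        levelTilde rnd x u v z * tiltedCapacity (profile rnd δ x u v ε) (boxB δ x 2 z) ≤
          (1 + ε₀) * (level rnd δ x u v ε z * capacity (boxB δ x 2 z)) ∧
        -- comparison of equilibrium measures
        ∀ y : ZLat d,
          (1 - ε₀) * (level rnd δ x u v ε z * eqMeasure (boxB δ x 1 z) y) ≤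
            levelTilde rnd x u v z *
              tiltedEqMeasure (profile rnd δ x u v ε) (boxB δ x 1 z) y ∧
          levelTilde rnd x u v z *
              tiltedEqMeasure (profile rnd δ x u v ε) (boxB δ x 1 z) y ≤
            (1 + ε₀) * (level rnd δ x u v ε z * eqMeasure (boxB δ x 1 z) y) := by
  have hu : 0 < u := hv.trans_le hvu
  have hε0 : 0 < ε := hε.1
  have hεc : ε < criticalLevel d / 10 := hε.2.trans_le (min_le_left _ _)
  have hap : 0 < (criticalLevel d + ε) / v := div_pos (by linarith) hv
  have hbp : 0 < (criticalLevel d - ε) / u := div_pos (by linarith) hu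
  set a := √((criticalLevel d + ε) / v) with ha
  set b := √((criticalLevel d - ε) / u) with hb
  have ha0 : 0 < a := Real.sqrt_pos.2 hap
  have hb0 : 0 < b := Real.sqrt_pos.2 hbp
  have hav : a ^ 2 * v = criticalLevel d + ε := by
    rw [ha, Real.sq_sqrt hap.le, div_mul_cancel₀ _ hv.ne']
  have hbu : b ^ 2 * u = criticalLevel d - ε := by
    rw [hb, Real.sq_sqrt hbp.le, div_mul_cancel₀ _ hu.ne']
  set c := min 1 (min a b) with hc
  set C := max 1 (max a b) with hC
  have hc0 : 0 < c := lt_min one_pos (lt_min ha0 hb0)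
  have h1 : 1 ∈ Icc c C := ⟨min_le_left _ _, le_max_left _ _⟩
  have haI : a ∈ Icc c C :=
    ⟨(min_le_right _ _).trans (min_le_left _ _), le_max_of_le_right (le_max_left _ _)⟩
  have hbI : b ∈ Icc c C :=
    ⟨(min_le_right _ _).trans (min_le_right _ _), le_max_of_le_right (le_max_right _ _)⟩
  obtain ⟨s₀, hs₀, hcmp⟩ := exists_scale_comparison hd hc0 h1 (half_pos hε₀.1)
    (by linarith [hε₀.2])
  refine ⟨max 100 (s₀ ^ (8 / δ)), lt_max_of_lt_left (by norm_num), fun rnd hr x hx z hz => ?_⟩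
  have hx100 : 100 ≤ eucNorm x := (le_max_left _ _).trans hx
  obtain ⟨s, hs⟩ : ∃ s, s = eucNorm x ^ (δ / 8) := ⟨_, rfl⟩
  have hss₀ : s₀ ≤ s := by
    have h2 : (s₀ ^ (8 / δ)) ^ (δ / 8) ≤ eucNorm x ^ (δ / 8) :=
      Real.rpow_le_rpow (by positivity) ((le_max_right _ _).trans hx) (by linarith [hδ.1])
    rwa [← Real.rpow_mul (by linarith), div_mul_div_comm, mul_comm 8 δ,
      div_self (by linarith [hδ.1]), Real.rpow_one, ← hs] at h2
  have hs10 : 10 ≤ s := hs₀.trans hss₀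
  obtain ⟨hT, hT6, h6U⟩ := tube_scales hδ hr hs hx100
  have hmono : ∀ i j : ℕ, i ≤ j → s ^ i ≤ s ^ j := fun i j h => pow_le_pow_right₀ (by linarith) h
  have hpos : ∀ i : ℕ, 1 ≤ s ^ i := fun i => one_le_pow₀ (by linarith)
  have m1 := hmono 16 24 (by norm_num)
  have m2 := hmono 24 40 (by norm_num)
  have m3 := hmono 32 40 (by norm_num)
  have m4 : 10 * s ^ 24 ≤ s ^ 32 := by
    have : s ^ 32 = s ^ 8 * s ^ 24 := by ring
    rw [this]
    have h10 : 10 ≤ s ^ 8 := by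
      have := hmono 1 8 (by norm_num)
      linarith
    exact mul_le_mul_of_nonneg_right h10 (by positivity)
  have m5 := hpos 24
  have h36 : tubeT rnd δ x 3 ⊆ tubeT6 rnd δ x := fun y hy => by
    rw [hT] at hy
    rw [hT6]
    norm_num at hy
    linarith
  set f := profile rnd δ x u v ε with hf
  have hfI : ∀ y, f y ∈ Icc c C := profile_mem_Icc h36 h6U h1 haI hbI
  have hf1 : {y | f y ≠ 1}.Finite := by
    refine (finite_box (0 : ZLat d) (10 ^ 3 * eucNorm x)).subset fun y hy => ?_
    by_contra hU
    exact hy (profile_eq_one (fun h => hU (h6U (h36 h))) hU)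
  -- near the segment `f` equals `b`, and near the boundary of `T⁴` it equals `a`
  have hint : z ∈ gammaInt rnd x → ∀ y, eucNorm (y - z) ≤ s ^ 16 → f y = b := by
    intro hz y hy
    have hle := segDist_le_add (rnd := rnd) (x := x) y z
    rw [segDist_eq_zero hz] at hle
    have h2 : y ∈ tubeT rnd δ x 2 := by
      rw [hT]; norm_num; linarith
    have h3 : y ∈ tubeT rnd δ x 3 := by
      rw [hT]; norm_num; linarith
    exact profile_eq_int h2 h3 (h36 h3) (h6U (h36 h3))
  have hzext : z ∈ gammaExt rnd δ x → segDist rnd x z ≤ s ^ 32 ∧ s ^ 32 - 1 < segDist rnd x z := by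
    rintro ⟨hz4, w, hw4, hzw⟩
    rw [hT] at hz4 hw4
    norm_num at hz4 hw4
    refine ⟨hz4, ?_⟩
    have hle := segDist_le_add (rnd := rnd) (x := x) w z
    rw [← dist_toEuc, dist_comm, hzw] at hle
    linarith
  have hext : z ∈ gammaExt rnd δ x → ∀ y, eucNorm (y - z) ≤ s ^ 16 → f y = a := by
    intro hz y hy
    obtain ⟨hz1, hz2⟩ := hzext hz
    have hle := segDist_le_add (rnd := rnd) (x := x) y z
    have hle' := segDist_le_add (rnd := rnd) (x := x) z y
    rw [eucNorm_sub_comm] at hle'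
    have h3 : y ∉ tubeT rnd δ x 3 := by
      rw [hT]; norm_num; linarith
    have h6 : y ∈ tubeT6 rnd δ x := by
      rw [hT6]; linarith
    exact profile_eq_ext h3 h6 (h6U h6)
  have hzz : eucNorm (z - z) ≤ s ^ 16 := by
    rw [← dist_toEuc, dist_self]; positivity
  have hdisj : z ∈ gammaExt rnd δ x → z ∉ gammaInt rnd x := fun hz hz' => by
    have := (hzext hz).2
    rw [segDist_eq_zero hz'] at this
    linarith
  have hconst : ∀ y, eucNorm (y - z) ≤ s ^ 16 → f y = f z := fun y hy => by
    rcases hz with hz | hz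
    · rw [hint hz y hy, hint hz z hzz]
    · rw [hext hz y hy, hext hz z hzz]
  have hlt0 : 0 ≤ levelTilde rnd x u v z := by
    unfold levelTilde
    split_ifs
    exacts [hu.le, hv.le]
  have hlevel : level rnd δ x u v ε z = f z ^ 2 * levelTilde rnd x u v z := rfl
  refine ⟨fun hz => ?_, fun hz => ?_, ?_⟩
  · have : levelTilde rnd x u v z = u := if_pos hz
    exact ⟨this, by rw [hlevel, this, hint hz z hzz, hbu]⟩
  · have : levelTilde rnd x u v z = v := if_neg (hdisj hz)
    exact ⟨this, by rw [hlevel, this, hext hz z hzz, hav]⟩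
  · rw [hlevel, ← and_assoc]
    obtain ⟨r₁, hr₁, e₁⟩ := exists_boxB_eq_box hs hx100 hs10 z (i := 1) (by norm_num)
    obtain ⟨r₂, hr₂, e₂⟩ := exists_boxB_eq_box hs hx100 hs10 z (i := 2) le_rfl
    rw [e₁, e₂]
    constructor
    · obtain ⟨c1, c2⟩ := capacity_comparison (finite_box z r₂)
        (hcmp s hss₀ f hfI hf1 z hconst r₂ hr₂)
      exact sandwich_mul hε₀ hlt0 (mul_nonneg (sq_nonneg _) (capacity_nonneg _)) c1 c2
    · intro y
      obtain ⟨c1, c2⟩ := hcmp s hss₀ f hfI hf1 z hconst r₁ hr₁ y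
      exact sandwich_mul hε₀ hlt0 (mul_nonneg (sq_nonneg _) (eqMeasure_nonneg _ _)) c1 c2
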